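/- Let $\mathfrak h$ be a finite-dimensional complex vector space with a non-degenerate symmetric bilinear form $(\cdot,\cdot)$. The tensor space $\mathfrak h\otimes\mathfrak h$ carries the associative product $(a\otimes b)(u\otimes v)=(b,u)\,a\otimes v$ and the trace $\mathrm{Tr}(a\otimes b)=(a,b)$; put $L_{a,b}=a\otimes b+b\otimes a$. These elements span the Jordan algebra $\mathcal J$ of symmetric tensors (type $B$). Let $\hat{\mathfrak h}=\mathfrak h\otimes\mathbb C[t,t^{-1}]\oplus\mathbb C c$ be the Heisenberg Lie algebra, with $c$ central and $[a(m),b(n)]=m(a,b)\delta_{m+n,0}\,c$, where $a(m)=a t^m$. In $U(\hat{\mathfrak h})$ let $\mathfrak L=\mathrm{span}\{a(m)b(n)\}$, a Lie algebra under $[x,y]_{new}=\frac1c[x,y]$, and let $L_{a,b}(m,n)=\frac12{:}a(m)b(n){:}$, where ${:}a(m)b(n){:}$ is $b(n)a(m)$ if $m\ge n$ and $a(m)b(n)$ otherwise. Let $\mathfrak B_+=\mathrm{span}\{L_{a,b}(m,n): m\ge0\text{ or }n\ge0\}$. For $r\in\mathbb C$ let $M_r$ be the quotient of the enveloping algebra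 $U(\mathfrak L)$ of $(\mathfrak L,[\cdot,\cdot]_{new})$ by the left ideal generated by $\mathfrak B_+$ and $c-r$, that is, the module induced from the one-dimensional module $\mathbb C1$ of $\mathfrak B_++\mathbb Cc$ on which $\mathfrak B_+$ acts by $0$ and $c$ by $r$. On $M_r$ consider the operators $L_{a,b}(l)=\sum_{k\in\mathbb Z}L_{a,b}(-k+l-1,k)$ (finite sums on each vector) and the fields $L_{a,b}(z)=\sum_{l\in\mathbb Z}L_{a,b}(l)z^{-l-1}$. The underlying space of the Ashihara–Miyamoto vertex operator algebra is $$V_{\mathcal J,r}=\mathrm{span}\{L_{a_1,b_1}(m_1)\cdots L_{a_n,b_n}(m_n)1\}\subseteq M_r .$$ Let $(V_{\mathcal J,r})_k$ be the subspace on which $\omega(1)=\sum_i L_{e_i,e_i}(1)$ acts as $k$, where $(e_i)$ is an orthonormal basis of $\mathfrak h$. **Theorem 1.** There is exactly one linear functional $1'$ on $V_{\mathcal J,r}$ with $\langle 1',1\rangle=1$ and $\langle 1',v\rangle=0$ for all $v\in(V_{\mathcal J,r})_k$, $k\ge1$. For all $n\ge0$, all $a_1,b_1,\dots,a_n,b_n\in\mathfrak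 h$ and all $z_1,\dots,z_n\in\mathbb C$ with $|z_1|>\cdots>|z_n|$, the series $$\langle1',L_{a_1,b_1}(z_1)\cdots L_{a_n,b_n}(z_n)1\rangle=\sum_{m\in\mathbb Z^n}\langle1',L_{a_1,b_1}(m_1)\cdots L_{a_n,b_n}(m_n)1\rangle\prod_{i=1}^n z_i^{-m_i-1}$$ converges absolutely, and $$\langle1',L_{a_1,b_1}(z_1)\cdots L_{a_n,b_n}(z_n)1\rangle=\sum_{\sigma}\Gamma(\sigma,T)\,\Gamma(\sigma;Z)\,r^{c(\sigma)},$$ where $T=(a_1,b_1)\cdots(a_n,b_n)$ and $\sigma$ runs over the permutations of $\{1,\dots,n\}$ without fixed points. If $\sigma=(k_{11}\cdots k_{1t_1})\cdots(k_{s1}\cdots k_{st_s})$ is the decomposition of $\sigma$ into disjoint cycles (so that $\sigma(k_{ij})=k_{i,j+1}$ cyclically in $j$), then $c(\sigma)=s$ and $$\Gamma(\sigma,T)=2^{-s-n}\prod_{i=1}^s\mathrm{Tr}\bigl(L_{a_{k_{i1}},b_{k_{i1}}}\cdots L_{a_{k_{it_i}},b_{k_{it_i}}}\bigr),\qquad \Gamma(\sigma;Z)=\prod_{i=1}^n\frac1{(z_i-z_{\sigma(i)})^2}.$$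 -/

import Mathlib

namespace JordanVOA

open TensorProduct

noncomputable section

variable {𝔥 : Type*} [AddCommGroup 𝔥] [Module ℂ 𝔥]

/-! ### The algebra of tensors `𝔥 ⊗ 𝔥` -/

/-- The associative product on `𝔥 ⊗ 𝔥`, `(a ⊗ b) (u ⊗ v) = (b, u) a ⊗ v`. -/
def tensorMul (B : LinearMap.BilinForm ℂ 𝔥) :
    (𝔥 ⊗[ℂ] 𝔥) →ₗ[ℂ] (𝔥 ⊗[ℂ] 𝔥) →ₗ[ℂ] (𝔥 ⊗[ℂ] 𝔥) :=
  TensorProduct.lift <| LinearMap.mk₂ ℂ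
    (fun a b => TensorProduct.map ((B b).smulRight a) LinearMap.id)
    (by intro a a' b; ext u v; simp [smul_add, TensorProduct.add_tmul])
    (by intro t a b; ext u v; simp [TensorProduct.smul_tmul', smul_smul, mul_comm])
    (by intro a b b'; ext u v; simp [add_smul, TensorProduct.add_tmul])
    (by intro t a b; ext u v; simp [TensorProduct.smul_tmul', mul_smul])

theorem tensorMul_tmul (B : LinearMap.BilinForm ℂ 𝔥) (a b u v : 𝔥) :
    tensorMul B (a ⊗ₜ b) (u ⊗ₜ v) = B b u • (a ⊗ₜ[ℂ] v) := by
  simp [tensorMul, TensorProduct.smul_tmul']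

/-- The product of a nonempty list of tensors (the value at the empty list is never used). -/
def tensorListProd (B : LinearMap.BilinForm ℂ 𝔥) : List (𝔥 ⊗[ℂ] 𝔥) → 𝔥 ⊗[ℂ] 𝔥
  | [] => 0
  | [x] => x
  | x :: y :: l => tensorMul B x (tensorListProd B (y :: l))

/-- The trace on `𝔥 ⊗ 𝔥`, `Tr (a ⊗ b) = (a, b)`. -/
def tensorTrace (B : LinearMap.BilinForm ℂ 𝔥) : (𝔥 ⊗[ℂ] 𝔥) →ₗ[ℂ] ℂ :=
  TensorProduct.lift B

/-- The symmetric tensor `L_{a,b} = a ⊗ b + b ⊗ a`. -/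
def symTensor (a b : 𝔥) : 𝔥 ⊗[ℂ] 𝔥 := a ⊗ₜ b + b ⊗ₜ a

/-! ### The Heisenberg Lie algebra -/

/-- The cocycle `(f, g) ↦ ∑ m, m (f m, g (-m))` on `𝔥 ⊗ ℂ[t, t⁻¹]`, the latter being written
as the space of finitely supported functions `ℤ → 𝔥`. -/
def cocycle (B : LinearMap.BilinForm ℂ 𝔥) : (ℤ →₀ 𝔥) →ₗ[ℂ] (ℤ →₀ 𝔥) →ₗ[ℂ] ℂ :=
  Finsupp.lsum ℂ fun m : ℤ =>
    LinearMap.mk₂ ℂ (fun (a : 𝔥) (g : ℤ →₀ 𝔥) => (m : ℂ) * B a (g (-m)))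
      (by intro a a' g; simp [mul_add])
      (by intro t a g; simp [mul_left_comm])
      (by intro a g g'; simp [mul_add])
      (by intro t a g; simp [mul_left_comm])

theorem cocycle_single (B : LinearMap.BilinForm ℂ 𝔥) (m n : ℤ) (a b : 𝔥) :
    cocycle B (Finsupp.single m a) (Finsupp.single n b) =
      if m + n = 0 then (m : ℂ) * B a b else 0 := by
  by_cases h : m + n = 0
  · have h' : n = -m := by omega
    subst h'
    simp [cocycle]
  · have h' : n ≠ -m := by omega
    simp [cocycle, h, h']

theorem cocycle_swap (B : LinearMap.BilinForm ℂ 𝔥) (hB : B.IsSymm) (f g : ℤ →₀ 𝔥) :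
    cocycle B f g = -cocycle B g f := by
  induction f using Finsupp.induction_linear with
  | zero => simp
  | add f₁ f₂ h₁ h₂ => simp [h₁, h₂, add_comm]
  | single m a =>
    induction g using Finsupp.induction_linear with
    | zero => simp
    | add f₁ f₂ h₁ h₂ => simp [h₁, h₂, add_comm]
    | single n b =>
      rw [cocycle_single, cocycle_single, add_comm n m, hB.eq b a]
      split_ifs with h
      · have h' : n = -m := by omega
        subst h'
        simp
      · simp

/-- The Heisenberg Lie algebra `𝔥 ⊗ ℂ[t, t⁻¹] ⊕ ℂ c` of `(𝔥, B)`: a pair `(f, s)` stands for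
`∑ m, f m ⊗ t ^ m + s c`. -/
@[nolint unusedArguments]
def Heisenberg (B : LinearMap.BilinForm ℂ 𝔥) (_hB : B.IsSymm) : Type _ := (ℤ →₀ 𝔥) × ℂ

section

variable (B : LinearMap.BilinForm ℂ 𝔥) (hB : B.IsSymm)

instance : AddCommGroup (Heisenberg B hB) := inferInstanceAs (AddCommGroup ((ℤ →₀ 𝔥) × ℂ))

instance : Module ℂ (Heisenberg B hB) := inferInstanceAs (Module ℂ ((ℤ →₀ 𝔥) × ℂ))

/-- `[a t^m, b t^n] = m (a, b) δ_{m+n,0} c` and `c` is central. -/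
instance : Bracket (Heisenberg B hB) (Heisenberg B hB) :=
  ⟨fun x y => ((0, cocycle B x.1 y.1) : (ℤ →₀ 𝔥) × ℂ)⟩

theorem bracket_def (x y : Heisenberg B hB) :
    ⁅x, y⁆ = ((0, cocycle B x.1 y.1) : (ℤ →₀ 𝔥) × ℂ) := rfl

instance : LieRing (Heisenberg B hB) where
  add_lie x y z := by
    refine Prod.ext ?_ ?_
    · exact (add_zero (0 : ℤ →₀ 𝔥)).symm
    · change cocycle B (x.1 + y.1) z.1 = cocycle B x.1 z.1 + cocycle B y.1 z.1
      simp
  lie_add x y z := by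
    refine Prod.ext ?_ ?_
    · exact (add_zero (0 : ℤ →₀ 𝔥)).symm
    · change cocycle B x.1 (y.1 + z.1) = cocycle B x.1 y.1 + cocycle B x.1 z.1
      simp
  lie_self x := by
    refine Prod.ext rfl ?_
    change cocycle B x.1 x.1 = 0
    have h := cocycle_swap B hB x.1 x.1
    linear_combination h / 2
  leibniz_lie x y z := by
    refine Prod.ext ?_ ?_
    · exact (add_zero (0 : ℤ →₀ 𝔥)).symm
    · change cocycle B x.1 0 = cocycle B 0 z.1 + cocycle B y.1 0
      simp

instance : LieAlgebra ℂ (Heisenberg B hB) where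
  lie_smul t x y := by
    refine Prod.ext ?_ ?_
    · exact (smul_zero t).symm
    · change cocycle B x.1 (t • y.1) = t • cocycle B x.1 y.1
      simp

/-! ### The Lie algebra of quadratic elements and its enveloping algebra -/

/-- The universal enveloping algebra of the Heisenberg Lie algebra. -/
abbrev UH : Type _ := UniversalEnvelopingAlgebra ℂ (Heisenberg B hB)

/-- The element `a(m) = a t^m`. -/
def osc (a : 𝔥) (m : ℤ) : UH B hB :=
  UniversalEnvelopingAlgebra.ι ℂ (show Heisenberg B hB from (Finsupp.single m a, (0 : ℂ)))

/-- The central element `c`. -/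
def central : UH B hB :=
  UniversalEnvelopingAlgebra.ι ℂ (show Heisenberg B hB from ((0 : ℤ →₀ 𝔥), (1 : ℂ)))

/-- The space `𝔏` spanned by the quadratic elements `a(m) b(n)`. -/
def quadSpace : Submodule ℂ (UH B hB) :=
  Submodule.span ℂ {x | ∃ (a b : 𝔥) (m n : ℤ), x = osc B hB a m * osc B hB b n}

/-- `L_{a,b}(m,n) = ½ :a(m) b(n):`, with the normal ordering `:a(m) b(n): = b(n) a(m)` for
`m ≥ n` and `:a(m) b(n): = a(m) b(n)` otherwise. -/
def quadElt (a b : 𝔥) (m n : ℤ) : UH B hB :=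
  (1 / 2 : ℂ) • if n ≤ m then osc B hB b n * osc B hB a m else osc B hB a m * osc B hB b n

theorem quadElt_mem (a b : 𝔥) (m n : ℤ) : quadElt B hB a b m n ∈ quadSpace B hB := by
  unfold quadElt
  refine Submodule.smul_mem _ _ ?_
  split_ifs
  · exact Submodule.subset_span ⟨b, a, n, m, rfl⟩
  · exact Submodule.subset_span ⟨a, b, m, n, rfl⟩

/-- The space `𝔅₊` spanned by the `L_{a,b}(m,n)` with `m ≥ 0` or `n ≥ 0`. -/
def posSpace : Submodule ℂ (UH B hB) :=
  Submodule.span ℂ {x | ∃ (a b : 𝔥) (m n : ℤ), (0 ≤ m ∨ 0 ≤ n) ∧ x = quadElt B hB a b m n}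

/-- The relations `x y = y x + w` for `x, y, w ∈ 𝔏` with `w = [x, y]_new = c⁻¹ [x, y]`, that is,
with `c w = x y - y x` in the enveloping algebra of the Heisenberg Lie algebra. -/
inductive EnvRel : TensorAlgebra ℂ (quadSpace B hB) → TensorAlgebra ℂ (quadSpace B hB) → Prop
  | of (x y w : quadSpace B hB)
      (h : central B hB * (w : UH B hB) = (x : UH B hB) * y - (y : UH B hB) * x) :
      EnvRel (TensorAlgebra.ι ℂ x * TensorAlgebra.ι ℂ y)
        (TensorAlgebra.ι ℂ y * TensorAlgebra.ι ℂ x + TensorAlgebra.ι ℂ w)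

/-- The universal enveloping algebra `U(𝔏)` of the Lie algebra `(𝔏, [ , ]_new)`. -/
def UL : Type _ := RingQuot (EnvRel B hB)

instance : Ring (UL B hB) := inferInstanceAs (Ring (RingQuot (EnvRel B hB)))

instance : Algebra ℂ (UL B hB) := inferInstanceAs (Algebra ℂ (RingQuot (EnvRel B hB)))

/-- The projection of the tensor algebra of `𝔏` onto `U(𝔏)`. -/
def projUL : TensorAlgebra ℂ (quadSpace B hB) →ₐ[ℂ] UL B hB :=
  RingQuot.mkAlgHom ℂ (EnvRel B hB)

/-- The canonical map `𝔏 → U(𝔏)`. -/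
def toUL : quadSpace B hB →ₗ[ℂ] UL B hB :=
  (projUL B hB).toLinearMap ∘ₗ TensorAlgebra.ι ℂ

theorem toUL_mul (x y w : quadSpace B hB)
    (h : central B hB * (w : UH B hB) = (x : UH B hB) * y - (y : UH B hB) * x) :
    toUL B hB x * toUL B hB y = toUL B hB y * toUL B hB x + toUL B hB w := by
  have := RingQuot.mkAlgHom_rel ℂ (EnvRel.of x y w h)
  change projUL B hB _ = projUL B hB _ at this
  simpa [toUL] using this

variable (r : ℂ)

/-- The left ideal of `U(𝔏)` generated by `𝔅₊` and `c - r`. -/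
def vacIdeal : Submodule (UL B hB) (UL B hB) :=
  Submodule.span (UL B hB)
    ({u | ∃ x : quadSpace B hB, (x : UH B hB) ∈ posSpace B hB ∧ u = toUL B hB x} ∪
     {u | ∃ x : quadSpace B hB, (x : UH B hB) = central B hB ∧
        u = toUL B hB x - algebraMap ℂ (UL B hB) r})

/-- The module `M_r = U(𝔏) ⊗_{U(𝔏₊)} ℂ 1` induced from the one-dimensional module of
`𝔏₊ = 𝔅₊ ⊕ ℂ c` on which `𝔅₊` acts by `0` and `c` by `r`. -/
def Mr : Type _ := UL B hB ⧸ vacIdeal B hB r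

instance : AddCommGroup (Mr B hB r) := inferInstanceAs (AddCommGroup (UL B hB ⧸ vacIdeal B hB r))

instance : Module (UL B hB) (Mr B hB r) :=
  inferInstanceAs (Module (UL B hB) (UL B hB ⧸ vacIdeal B hB r))

instance : Module ℂ (Mr B hB r) := Module.compHom (Mr B hB r) (algebraMap ℂ (UL B hB))

instance : IsScalarTower ℂ (UL B hB) (Mr B hB r) where
  smul_assoc t u v := by
    change (t • u) • v = algebraMap ℂ (UL B hB) t • u • v
    rw [Algebra.smul_def, mul_smul]

/-- The projection of `U(𝔏)` onto `M_r`. -/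
def toMr : UL B hB →ₗ[UL B hB] Mr B hB r := (vacIdeal B hB r).mkQ

/-- The vacuum vector `1` of `M_r`. -/
def vac : Mr B hB r := toMr B hB r 1

/-- The action of `L_{a,b}(m,n)` on `M_r`. -/
def act (a b : 𝔥) (m n : ℤ) : Module.End ℂ (Mr B hB r) :=
  Module.toModuleEnd ℂ (S := UL B hB) (Mr B hB r) (toUL B hB ⟨quadElt B hB a b m n, quadElt_mem B hB a b m n⟩)

theorem act_apply (a b : 𝔥) (m n : ℤ) (v : Mr B hB r) :
    act B hB r a b m n v =
      toUL B hB ⟨quadElt B hB a b m n, quadElt_mem B hB a b m n⟩ • v := rfl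

theorem osc_commute (a b : 𝔥) (m n : ℤ) (h : m + n ≠ 0) :
    Commute (osc B hB a m) (osc B hB b n) := by
  let _ : LieRing (UH B hB) := LieRing.ofAssociativeRing
  let x : Heisenberg B hB := (Finsupp.single m a, (0 : ℂ))
  let y : Heisenberg B hB := (Finsupp.single n b, (0 : ℂ))
  have h1 : ⁅x, y⁆ = 0 := by
    rw [bracket_def]
    refine Prod.ext rfl ?_
    change cocycle B (Finsupp.single m a) (Finsupp.single n b) = 0
    rw [cocycle_single, if_neg h]
  have h2 : osc B hB a m * osc B hB b n - osc B hB b n * osc B hB a m =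
      UniversalEnvelopingAlgebra.ι ℂ ⁅x, y⁆ :=
    ((UniversalEnvelopingAlgebra.ι ℂ (L := Heisenberg B hB)).map_lie x y).symm
  rw [h1, map_zero] at h2
  exact sub_eq_zero.mp h2

theorem quadElt_commute (a b u v : 𝔥) (m n p q : ℤ) (h1 : m + p ≠ 0) (h2 : m + q ≠ 0)
    (h3 : n + p ≠ 0) (h4 : n + q ≠ 0) :
    Commute (quadElt B hB a b m n) (osc B hB u p * osc B hB v q) := by
  have ha := (osc_commute B hB a u m p h1).mul_right (osc_commute B hB a v m q h2)
  have hb := (osc_commute B hB b u n p h3).mul_right (osc_commute B hB b v n q h4)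
  unfold quadElt
  refine Commute.smul_left ?_ _
  split_ifs
  · exact hb.mul_left ha
  · exact ha.mul_left hb

/-- Only finitely many terms of the sum `∑ k, L_{a,b}(-k+l-1,k) v` are nonzero. -/
def LocFin (v : Mr B hB r) : Prop :=
  ∀ (a b : 𝔥) (l : ℤ), (Function.support fun k : ℤ => act B hB r a b (-k + l - 1) k v).Finite

variable {B hB r}

theorem LocFin.add {v w : Mr B hB r} (hv : LocFin B hB r v) (hw : LocFin B hB r w) :
    LocFin B hB r (v + w) := by
  intro a b l
  refine ((hv a b l).union (hw a b l)).subset fun k hk => ?_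
  by_contra hc
  simp only [Set.mem_union, Function.mem_support, not_or, not_not] at hc
  exact hk (by simp [hc.1, hc.2])

theorem LocFin.smul {v : Mr B hB r} (hv : LocFin B hB r v) (t : ℂ) :
    LocFin B hB r (t • v) := by
  intro a b l
  refine (hv a b l).subset fun k hk hc => hk ?_
  simp only [] at hc
  simp [hc]

theorem LocFin.toUL_smul (x : quadSpace B hB) :
    ∀ v : Mr B hB r, LocFin B hB r v → LocFin B hB r (toUL B hB x • v) := by
  obtain ⟨x, hx⟩ := x
  induction hx using Submodule.span_induction with
  | mem x hx =>
    obtain ⟨u, w, p, q, rfl⟩ := id hx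
    intro v hv a b l
    refine ((hv a b l).union (Set.toFinite ({-p, -q, l - 1 + p, l - 1 + q} : Set ℤ))).subset ?_
    intro k hk
    by_contra hc
    simp only [Set.mem_union, Function.mem_support, not_or, not_not, Set.mem_insert_iff,
      Set.mem_singleton_iff] at hc
    obtain ⟨hc0, h1, h2, h3, h4⟩ := hc
    apply hk
    have hcomm := quadElt_commute B hB a b u w (-k + l - 1) k p q (by omega) (by omega)
      (by omega) (by omega)
    have hrel := toUL_mul B hB ⟨_, quadElt_mem B hB a b (-k + l - 1) k⟩
      ⟨_, Submodule.subset_span hx⟩ 0 (by simp [hcomm.eq])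
    rw [map_zero, add_zero] at hrel
    rw [act_apply] at hc0
    simp only [act_apply]
    rw [smul_smul, hrel, ← smul_smul, hc0, smul_zero]
  | zero =>
    intro v hv
    have h0 : (⟨0, Submodule.zero_mem _⟩ : quadSpace B hB) = 0 := rfl
    have := hv.smul 0
    rw [zero_smul] at this
    simpa [h0] using this
  | add x y hx hy ihx ihy =>
    intro v hv
    have h0 : (⟨x + y, Submodule.add_mem _ hx hy⟩ : quadSpace B hB) = ⟨x, hx⟩ + ⟨y, hy⟩ := rfl
    rw [h0, map_add, add_smul]
    exact (ihx v hv).add (ihy v hv)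
  | smul t x hx ih =>
    intro v hv
    have h0 : (⟨t • x, Submodule.smul_mem _ t hx⟩ : quadSpace B hB) = t • ⟨x, hx⟩ := rfl
    rw [h0, map_smul, smul_assoc]
    exact (ih v hv).smul t

theorem locFin_vac : LocFin B hB r (vac B hB r) := by
  intro a b l
  refine (Set.finite_Icc l 0).subset fun k hk => ?_
  by_contra hc
  apply hk
  simp only [Set.mem_Icc, not_and_or, not_le] at hc
  simp only [act_apply, vac]
  rw [← map_smul, smul_eq_mul, mul_one]
  refine (Submodule.Quotient.mk_eq_zero (vacIdeal B hB r)).mpr ?_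
  refine Submodule.subset_span (Or.inl ⟨_, Submodule.subset_span ⟨a, b, _, _, ?_, rfl⟩, rfl⟩)
  omega

theorem locFin (v : Mr B hB r) : LocFin B hB r v := by
  have key : ∀ (t : TensorAlgebra ℂ (quadSpace B hB)) (v : Mr B hB r), LocFin B hB r v →
      LocFin B hB r (projUL B hB t • v) := by
    intro t
    induction t using TensorAlgebra.induction with
    | algebraMap s =>
      intro v hv
      rw [AlgHom.commutes, algebraMap_smul]
      exact hv.smul s
    | ι x => exact LocFin.toUL_smul x
    | mul x y hx hy =>
      intro v hv
      rw [map_mul, mul_smul]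
      exact hx _ (hy _ hv)
    | add x y hx hy =>
      intro v hv
      rw [map_add, add_smul]
      exact (hx _ hv).add (hy _ hv)
  obtain ⟨u, rfl⟩ : ∃ u, toMr B hB r u = v := Submodule.mkQ_surjective (vacIdeal B hB r) v
  obtain ⟨t, rfl⟩ : ∃ t, projUL B hB t = u := RingQuot.mkAlgHom_surjective ℂ (EnvRel B hB) u
  have := key t _ locFin_vac
  rwa [vac, ← map_smul, smul_eq_mul, mul_one] at this

variable (B hB r)

/-- The operator `L_{a,b}(l) = ∑ k, L_{a,b}(-k+l-1,k)` on `M_r`; on each vector the sum is finite.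
It is the coefficient of `z^(-l-1)` in the field `L_{a,b}(z)`. -/
def mode (a b : 𝔥) (l : ℤ) : Module.End ℂ (Mr B hB r) where
  toFun v := ∑ᶠ k : ℤ, act B hB r a b (-k + l - 1) k v
  map_add' v w := by
    simp only [map_add]
    exact finsum_add_distrib (locFin v a b l) (locFin w a b l)
  map_smul' t v := by
    simp only [map_smul, RingHom.id_apply]
    exact (smul_finsum' t (locFin v a b l)).symm

/-! ### The vertex algebra `V_{𝒥,r}` and its correlation functions -/

/-- The vector `L_{a_1,b_1}(m_1) ⋯ L_{a_n,b_n}(m_n) 1`. -/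
def modeWord {n : ℕ} (a b : Fin n → 𝔥) (m : Fin n → ℤ) : Mr B hB r :=
  (List.ofFn fun i => mode B hB r (a i) (b i) (m i)).prod (vac B hB r)

/-- The space `V_{𝒥,r}` spanned by all vectors `L_{a_1,b_1}(m_1) ⋯ L_{a_n,b_n}(m_n) 1`. -/
def V : Submodule ℂ (Mr B hB r) :=
  Submodule.span ℂ {v | ∃ (n : ℕ) (a b : Fin n → 𝔥) (m : Fin n → ℤ), v = modeWord B hB r a b m}

/-- `L_{a_1,b_1}(m_1) ⋯ L_{a_n,b_n}(m_n) 1` as an element of `V_{𝒥,r}`. -/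
def wordV {n : ℕ} (a b : Fin n → 𝔥) (m : Fin n → ℤ) : V B hB r :=
  ⟨modeWord B hB r a b m, Submodule.subset_span ⟨n, a, b, m, rfl⟩⟩

/-- The vacuum vector as an element of `V_{𝒥,r}`. -/
def vacV : V B hB r :=
  ⟨vac B hB r, Submodule.subset_span ⟨0, Fin.elim0, Fin.elim0, Fin.elim0, by simp [modeWord]⟩⟩

/-- The operator `ω(1)`, for the Virasoro element `ω = ∑ i, L_{e_i,e^i}(-1,-1) 1`, where `(e_i)` is
a basis of `𝔥` and `(e^i)` its dual basis. This does not depend on the basis, and `e^i = e_i` for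
an orthonormal one. -/
def conformalOp [FiniteDimensional ℂ 𝔥] (hN : B.Nondegenerate) : Module.End ℂ (Mr B hB r) :=
  ∑ i, mode B hB r (Module.finBasis ℂ 𝔥 i) (B.dualBasis hN (Module.finBasis ℂ 𝔥) i) 1

/-- The homogeneous subspace `(V_{𝒥,r})_k`: the vectors on which `ω(1)` acts as `k`. -/
def weightSpace [FiniteDimensional ℂ 𝔥] (hN : B.Nondegenerate) (k : ℕ) :
    Submodule ℂ (V B hB r) :=
  ((conformalOp B hB r hN).eigenspace (k : ℂ)).comap (V B hB r).subtype

/-- The linear functional `φ` on `V_{𝒥,r}` is `1'`: it takes the value `1` at the vacuum vector and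
vanishes on `(V_{𝒥,r})_k` for all `k ≥ 1`. -/
def IsVacuumFunctional [FiniteDimensional ℂ 𝔥] (hN : B.Nondegenerate)
    (φ : Module.Dual ℂ (V B hB r)) : Prop :=
  φ (vacV B hB r) = 1 ∧ ∀ k : ℕ, 1 ≤ k → ∀ v ∈ weightSpace B hB r hN k, φ v = 0

end

/-! ### The right-hand side -/

/-- The entries `k_1, k_2 = τ k_1, …, k_t` of a cycle `τ = (k_1 ⋯ k_t)`, read from its smallest
entry. -/
def cycleEntries {n : ℕ} (τ : Equiv.Perm (Fin n)) : List (Fin n) :=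
  if h : τ.support.Nonempty then τ.toList (τ.support.min' h) else []

/-- `Γ(σ, T) = 2^(-s-n) ∏ Tr (L_{a_{k_1},b_{k_1}} ⋯ L_{a_{k_t},b_{k_t}})`, the product being over
the `s` cycles `(k_1 ⋯ k_t)` of the derangement `σ`. -/
def gammaT (B : LinearMap.BilinForm ℂ 𝔥) {n : ℕ} (a b : Fin n → 𝔥) (σ : Equiv.Perm (Fin n)) : ℂ :=
  (2 : ℂ) ^ (-(σ.cycleFactorsFinset.card : ℤ) - (n : ℤ)) *
    ∏ τ ∈ σ.cycleFactorsFinset,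
      tensorTrace B
        (tensorListProd B ((cycleEntries τ).map fun k => symTensor (a k) (b k)))

/-- `Γ(σ; Z) = ∏ i, 1 / (z_i - z_{σ(i)})²`. -/
def gammaZ {n : ℕ} (z : Fin n → ℂ) (σ : Equiv.Perm (Fin n)) : ℂ :=
  ∏ i, 1 / (z i - z (σ i)) ^ 2

end

end JordanVOA

namespace JordanVOA

open TensorProduct

noncomputable section

variable {𝔥 : Type*} [AddCommGroup 𝔥] [Module ℂ 𝔥]
variable (B : LinearMap.BilinForm ℂ 𝔥) (hB : B.IsSymm)

/-! ### Commutators in the enveloping algebra of the Heisenberg Lie algebra -/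

/-! For r = 2N with N a natural number, 𝔏 acts on a Fock space: take 2N commuting level-one copies
of the Heisenberg algebra (real bosons) and let a quadratic element act by the sum of its actions in
the copies. In each copy c acts by 1, so the new bracket becomes the commutator, and c as an element
of 𝔏 acts by 2N (`fockSum_mul`, `fockSum_central`). Pairing the real bosons into N complex ones
turns L_{a,b}(m,n) into a sum over N colours of normally ordered products of a field with a
conjugate field (`fockSum_quadElt`). Wick's theorem for complex fields gives a permanent
(`WickSystem.corr_univ`): σ(i) is the site whose conjugate field contracts with the field at i.
Normal ordering excludes fixed points. A contraction needs equal colours, so colours are constant on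
cycles, and summing over them produces N^c(σ) (`card_invariant`, `vev_fockSum`).

The vacuum expectation value of any element of U(𝔏) is a polynomial in N (`exists_vevPoly`). What
holds for all N is a polynomial identity, so its value at r/2 descends to a functional on M_r for
every complex r (`vevPoly_vacIdeal`), without any knowledge of a basis of M_r. This functional is 1
at the vacuum and kills the image of ω(1). Conversely, M_r is spanned by words in negative modes
(`iSup_negSpan`), which are eigenvectors of ω(1) of positive weight except for the vacuum; hence a
functional with the properties of 1' exists and is unique (`isVacuumFunctional_iff`).

For the generating function, the modes of one contraction sum to (z - w)⁻² (`hasSum_vacPair`). Along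
a permutation these double series are independent and absolutely convergent, and multiply to Γ(σ;Z).
The choice, at each site, of which of a_i, b_i belongs to the field is the expansion of a ⊗ b + b ⊗
a, and the pairings along a cycle form a trace (`tensorTrace_cycle`, `gammaT_eq`). -/

/-- The structure constant of `[a(m), b(n)]`. -/
def oscPair (a b : 𝔥) (m n : ℤ) : ℂ := if m + n = 0 then (m : ℂ) * B a b else 0

theorem ι_mul_ι (x y : Heisenberg B hB) :
    UniversalEnvelopingAlgebra.ι ℂ x * UniversalEnvelopingAlgebra.ι ℂ y =
      UniversalEnvelopingAlgebra.ι ℂ y * UniversalEnvelopingAlgebra.ι ℂ x +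
        cocycle B x.1 y.1 • central B hB := by
  let _ : LieRing (UH B hB) := LieRing.ofAssociativeRing
  have h : UniversalEnvelopingAlgebra.ι ℂ x * UniversalEnvelopingAlgebra.ι ℂ y -
      UniversalEnvelopingAlgebra.ι ℂ y * UniversalEnvelopingAlgebra.ι ℂ x =
      UniversalEnvelopingAlgebra.ι ℂ ⁅x, y⁆ :=
    ((UniversalEnvelopingAlgebra.ι ℂ (L := Heisenberg B hB)).map_lie x y).symm
  have h2 : ⁅x, y⁆ = cocycle B x.1 y.1 •
      (show Heisenberg B hB from ((0 : ℤ →₀ 𝔥), (1 : ℂ))) := by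
    rw [bracket_def]
    refine Prod.ext ?_ ?_
    · exact (smul_zero _).symm
    · exact (mul_one _).symm
  rw [h2, map_smul] at h
  rw [← sub_eq_iff_eq_add']
  exact h

theorem osc_mul_osc (a b : 𝔥) (m n : ℤ) :
    osc B hB a m * osc B hB b n =
      osc B hB b n * osc B hB a m + oscPair B a b m n • central B hB := by
  have h := ι_mul_ι B hB (show Heisenberg B hB from (Finsupp.single m a, (0 : ℂ)))
    (show Heisenberg B hB from (Finsupp.single n b, (0 : ℂ)))
  refine h.trans ?_
  congr 2
  exact cocycle_single B m n a b

theorem central_mul_osc (a : 𝔥) (m : ℤ) :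
    central B hB * osc B hB a m = osc B hB a m * central B hB := by
  have h := ι_mul_ι B hB (show Heisenberg B hB from ((0 : ℤ →₀ 𝔥), (1 : ℂ)))
    (show Heisenberg B hB from (Finsupp.single m a, (0 : ℂ)))
  refine h.trans ?_
  have h0 : cocycle B (show Heisenberg B hB from ((0 : ℤ →₀ 𝔥), (1 : ℂ))).1
    (show Heisenberg B hB from (Finsupp.single m a, (0 : ℂ))).1 = 0 :=
    LinearMap.map_zero₂ _ _
  rw [h0, zero_smul, add_zero]
  rfl

theorem central_comm_quadSpace (x : UH B hB) (hx : x ∈ quadSpace B hB) :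
    central B hB * x = x * central B hB := by
  induction hx using Submodule.span_induction with
  | mem x hx =>
    obtain ⟨a, b, m, n, rfl⟩ := hx
    rw [← mul_assoc, central_mul_osc, mul_assoc, central_mul_osc, mul_assoc]
  | zero => simp
  | add x y _ _ hx hy => rw [mul_add, add_mul, hx, hy]
  | smul t x _ hx => rw [mul_smul_comm, smul_mul_assoc, hx]

/-- `c⁻¹ [L_{a,b}(m,n), u(p)]`. -/
def quadAd (a b : 𝔥) (m n : ℤ) (u : 𝔥) (p : ℤ) : UH B hB :=
  (1 / 2 : ℂ) • (oscPair B b u n p • osc B hB a m + oscPair B a u m p • osc B hB b n)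

/-- Leibniz rule with c collected on the left: the new bracket is never formed by dividing by c,
only recognised through an equation c w = x y - y x. -/
theorem mul_mul_eq_of_comm {A : Type*} [Ring A] [Algebra ℂ A] {x y u c : A} {s t : ℂ}
    (hx : x * u = u * x + s • c) (hy : y * u = u * y + t • c) (hc : c * y = y * c)
    (hc' : c * x = x * c) :
    x * y * u = u * (x * y) + c * (t • x + s • y) := by
  rw [mul_assoc, hy, mul_add, ← mul_assoc, hx]
  simp only [add_mul, mul_add, mul_smul_comm, smul_mul_assoc, hc, hc', mul_assoc]
  abel

/-- The two orderings differ by a multiple of the central element, so the bracket does not see the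
normal ordering. -/
theorem quadElt_mul_osc (a b : 𝔥) (m n : ℤ) (u : 𝔥) (p : ℤ) :
    quadElt B hB a b m n * osc B hB u p =
      osc B hB u p * quadElt B hB a b m n + central B hB * quadAd B hB a b m n u p := by
  unfold quadElt quadAd
  rw [smul_mul_assoc, mul_smul_comm, mul_smul_comm, ← smul_add]
  congr 1
  split_ifs
  · rw [mul_mul_eq_of_comm (osc_mul_osc B hB b u n p) (osc_mul_osc B hB a u m p)
      (central_mul_osc B hB a m) (central_mul_osc B hB b n), add_comm (oscPair B a u m p • _)]
  · exact mul_mul_eq_of_comm (osc_mul_osc B hB a u m p) (osc_mul_osc B hB b u n p)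
      (central_mul_osc B hB b n) (central_mul_osc B hB a m)

theorem mul_mul_eq_of_ad {A : Type*} [Ring A] {S u v U W c : A}
    (hu : S * u = u * S + c * U) (hv : S * v = v * S + c * W) (hc : c * u = u * c) :
    S * (u * v) = u * v * S + c * (u * W + U * v) := by
  rw [← mul_assoc, hu, add_mul, mul_assoc, hv, mul_add, mul_add, ← mul_assoc, ← mul_assoc,
    ← mul_assoc c u W, hc, mul_assoc c U v, add_assoc]

theorem quadElt_mul_osc_osc (a b : 𝔥) (m n : ℤ) (u v : 𝔥) (p q : ℤ) :
    quadElt B hB a b m n * (osc B hB u p * osc B hB v q) =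
      osc B hB u p * osc B hB v q * quadElt B hB a b m n +
        central B hB * (osc B hB u p * quadAd B hB a b m n v q +
          quadAd B hB a b m n u p * osc B hB v q) :=
  mul_mul_eq_of_ad (quadElt_mul_osc B hB a b m n u p) (quadElt_mul_osc B hB a b m n v q)
    (central_mul_osc B hB u p)

theorem osc_mul_osc_mem (a b : 𝔥) (m n : ℤ) :
    osc B hB a m * osc B hB b n ∈ quadSpace B hB :=
  Submodule.subset_span ⟨a, b, m, n, rfl⟩

theorem quadAd_mem (a b : 𝔥) (m n : ℤ) (u v : 𝔥) (p q : ℤ) :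
    osc B hB u p * quadAd B hB a b m n v q + quadAd B hB a b m n u p * osc B hB v q ∈
      quadSpace B hB := by
  unfold quadAd
  simp only [mul_smul_comm, smul_mul_assoc, mul_add, add_mul]
  refine Submodule.add_mem _ ?_ ?_ <;>
  exact Submodule.smul_mem _ _ (Submodule.add_mem _
    (Submodule.smul_mem _ _ (osc_mul_osc_mem B hB _ _ _ _))
    (Submodule.smul_mem _ _ (osc_mul_osc_mem B hB _ _ _ _)))

theorem osc_mul_osc_eq_quadElt (a b : 𝔥) (m n : ℤ) :
    osc B hB a m * osc B hB b n = (2 : ℂ) • quadElt B hB a b m n +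
      (if n ≤ m then oscPair B a b m n else 0) • central B hB := by
  unfold quadElt
  rw [smul_smul]
  norm_num
  split_ifs
  · exact osc_mul_osc B hB a b m n
  · simp

theorem osc_add (a b : 𝔥) (m : ℤ) : osc B hB (a + b) m = osc B hB a m + osc B hB b m := by
  unfold osc
  rw [← map_add]
  congr 1
  refine Prod.ext ?_ ?_
  · exact Finsupp.single_add _ _ _
  · exact (add_zero _).symm

theorem osc_smul (t : ℂ) (a : 𝔥) (m : ℤ) : osc B hB (t • a) m = t • osc B hB a m := by
  unfold osc
  rw [← map_smul]
  congr 1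
  refine Prod.ext ?_ ?_
  · exact (Finsupp.smul_single _ _ _).symm
  · exact (smul_zero t).symm

/-- `𝔥 → U(ĥ)`, `a ↦ a(m)`. -/
def oscHom (m : ℤ) : 𝔥 →ₗ[ℂ] UH B hB where
  toFun a := osc B hB a m
  map_add' a b := osc_add B hB a b m
  map_smul' t a := osc_smul B hB t a m

/-! ### The bracket with the summands of ω(1). -/

section Conformal

variable [FiniteDimensional ℂ 𝔥] (hN : B.Nondegenerate)

/-- The `k`-th summand of `ω(1)`. -/
def conformalTerm (k : ℤ) : UH B hB :=
  ∑ i, quadElt B hB (Module.finBasis ℂ 𝔥 i) (B.dualBasis hN (Module.finBasis ℂ 𝔥) i) (-k) k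

theorem conformalTerm_mem (k : ℤ) : conformalTerm B hB hN k ∈ quadSpace B hB :=
  Submodule.sum_mem _ fun _ _ => quadElt_mem B hB _ _ _ _

/-- The eigenvalue of `c⁻¹ [conformalTerm k, ·]` on `u(p)`. -/
def conformalEigen (k p : ℤ) : ℂ :=
  (1 / 2 : ℂ) * ((if k + p = 0 then (k : ℂ) else 0) + (if -k + p = 0 then (-k : ℂ) else 0))

/-- Completeness of a basis and its dual basis. It collapses the sum over i in the bracket of ω(1)
with u(p) to a multiple of u(p). -/
theorem sum_pairing_dualBasis (hB : B.IsSymm) (u : 𝔥) :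
    ∑ i, B (B.dualBasis hN (Module.finBasis ℂ 𝔥) i) u • Module.finBasis ℂ 𝔥 i = u ∧
    ∑ i, B (Module.finBasis ℂ 𝔥 i) u • B.dualBasis hN (Module.finBasis ℂ 𝔥) i = u := by
  constructor
  · conv_rhs => rw [← (Module.finBasis ℂ 𝔥).sum_repr u]
    refine Finset.sum_congr rfl fun i _ => ?_
    congr 1
    conv_lhs => rw [← (Module.finBasis ℂ 𝔥).sum_repr u]
    rw [map_sum]
    simp only [map_smul, LinearMap.BilinForm.apply_dualBasis_left]
    simp
  · conv_rhs => rw [← (B.dualBasis hN (Module.finBasis ℂ 𝔥)).sum_repr u]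
    refine Finset.sum_congr rfl fun i _ => ?_
    congr 1
    conv_lhs => rw [← (B.dualBasis hN (Module.finBasis ℂ 𝔥)).sum_repr u]
    rw [map_sum]
    simp only [map_smul, LinearMap.BilinForm.apply_dualBasis_right hN hB]
    simp

theorem conformalTerm_mul_osc (k : ℤ) (u : 𝔥) (p : ℤ) :
    conformalTerm B hB hN k * osc B hB u p =
      osc B hB u p * conformalTerm B hB hN k +
        central B hB * (conformalEigen k p • osc B hB u p) := by
  unfold conformalTerm
  rw [Finset.sum_mul, Finset.mul_sum]
  simp only [quadElt_mul_osc]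
  rw [Finset.sum_add_distrib]
  congr 1
  rw [← Finset.mul_sum]
  congr 1
  obtain ⟨h1, h2⟩ := sum_pairing_dualBasis B hN hB u
  unfold quadAd conformalEigen
  rw [← Finset.smul_sum, mul_smul, Finset.sum_add_distrib, add_smul]
  congr 2
  · unfold oscPair
    split_ifs with h
    · have hp : p = -k := by omega
      conv_rhs => rw [← h1]
      simp only [mul_smul]
      rw [← Finset.smul_sum, hp]
      congr 1
      change _ = oscHom B hB (-k) _
      rw [map_sum]
      simp [oscHom]
    · simp
  · unfold oscPair
    split_ifs with h
    · have hp : p = k := by omega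
      conv_rhs => rw [← h2]
      simp only [mul_smul]
      rw [← Finset.smul_sum, hp]
      push_cast
      congr 1
      change _ = oscHom B hB k _
      rw [map_sum]
      simp [oscHom]
    · simp

theorem conformalTerm_mul_osc_osc (k : ℤ) (u v : 𝔥) (p q : ℤ) :
    conformalTerm B hB hN k * (osc B hB u p * osc B hB v q) =
      osc B hB u p * osc B hB v q * conformalTerm B hB hN k +
        central B hB * ((conformalEigen k p + conformalEigen k q) •
          (osc B hB u p * osc B hB v q)) := by
  rw [mul_mul_eq_of_ad (conformalTerm_mul_osc B hB hN k u p)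
    (conformalTerm_mul_osc B hB hN k v q) (central_mul_osc B hB u p)]
  congr 2
  rw [mul_smul_comm, smul_mul_assoc, add_smul, add_comm]

theorem conformalTerm_mul_quadElt (k : ℤ) (u v : 𝔥) (p q : ℤ) :
    conformalTerm B hB hN k * quadElt B hB u v p q =
      quadElt B hB u v p q * conformalTerm B hB hN k +
        central B hB * ((conformalEigen k p + conformalEigen k q) • quadElt B hB u v p q) := by
  unfold quadElt
  split_ifs
  · rw [mul_smul_comm, conformalTerm_mul_osc_osc, smul_add, smul_mul_assoc, ← mul_smul_comm,
      ← mul_smul_comm, smul_comm, add_comm (conformalEigen k p)]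
  · rw [mul_smul_comm, conformalTerm_mul_osc_osc, smul_add, smul_mul_assoc, ← mul_smul_comm,
      ← mul_smul_comm, smul_comm]

theorem support_conformalEigen (p : ℤ) :
    (Function.support fun k => conformalEigen k p) ⊆ ({p, -p} : Finset ℤ) := by
  intro k hk
  by_contra hc
  simp only [Finset.coe_insert, Finset.coe_singleton, Set.mem_insert_iff,
    Set.mem_singleton_iff, not_or] at hc
  apply hk
  simp only [conformalEigen]
  rw [if_neg (by omega), if_neg (by omega)]
  simp

/-- The indices k = p and k = -p contribute -p/2 each; they coincide for p = 0, where the term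
vanishes. -/
theorem finsum_conformalEigen (p : ℤ) : ∑ᶠ k : ℤ, conformalEigen k p = -p := by
  rw [finsum_eq_sum_of_support_subset _ (support_conformalEigen p)]
  by_cases h : p = 0
  · subst h
    simp [conformalEigen]
  · rw [Finset.sum_pair (by omega)]
    simp only [conformalEigen]
    rw [if_neg (by omega), if_pos (by omega), if_pos (by omega), if_neg (by omega)]
    push_cast
    ring

end Conformal

end

end JordanVOA

namespace JordanVOA

open TensorProduct

noncomputable section

variable {𝔥 : Type*} [AddCommGroup 𝔥] [Module ℂ 𝔥]
variable (B : LinearMap.BilinForm ℂ 𝔥) (hB : B.IsSymm)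

/-! ### The structure of `M_r` -/

/-- `L_{a,b}(m,n)` as an element of `𝔏`. -/
def quad (a b : 𝔥) (m n : ℤ) : quadSpace B hB := ⟨quadElt B hB a b m n, quadElt_mem B hB a b m n⟩

theorem toUL_smul_smul (r : ℂ) (x y w : quadSpace B hB)
    (h : (x : UH B hB) * y = (y : UH B hB) * x + central B hB * (w : UH B hB)) (v : Mr B hB r) :
    toUL B hB x • toUL B hB y • v = toUL B hB y • toUL B hB x • v + toUL B hB w • v := by
  rw [smul_smul, smul_smul, ← add_smul, toUL_mul B hB x y w (by rw [h]; abel)]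

theorem UL_induction {C : UL B hB → Prop} (hal : ∀ s : ℂ, C (algebraMap ℂ _ s))
    (hι : ∀ x, C (toUL B hB x)) (hmul : ∀ u v, C u → C v → C (u * v))
    (hadd : ∀ u v, C u → C v → C (u + v)) (u : UL B hB) : C u := by
  obtain ⟨t, rfl⟩ : ∃ t, projUL B hB t = u := RingQuot.mkAlgHom_surjective ℂ (EnvRel B hB) u
  induction t using TensorAlgebra.induction with
  | algebraMap s => rw [AlgHom.commutes]; exact hal s
  | ι x => exact hι x
  | mul x y hx hy => rw [map_mul]; exact hmul _ _ hx hy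
  | add x y hx hy => rw [map_add]; exact hadd _ _ hx hy

/-- The new bracket of c with 𝔏 is zero. The element c enters as an `x` lying over it because c need
not belong to 𝔏, for instance when 𝔥 = 0. -/
theorem toUL_central_comm (x : quadSpace B hB) (hx : (x : UH B hB) = central B hB)
    (u : UL B hB) : toUL B hB x * u = u * toUL B hB x := by
  induction u using UL_induction with
  | hal s => exact (Algebra.commutes s _).symm
  | hι y =>
    have := toUL_mul B hB x y 0 (by
      rw [hx, central_comm_quadSpace B hB y y.2, sub_self]; simp)
    rwa [map_zero, add_zero] at this
  | hmul u v hu hv => rw [← mul_assoc, hu, mul_assoc, hv, mul_assoc]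
  | hadd u v hu hv => rw [mul_add, add_mul, hu, hv]

/-- Reordering a(m) b(n) costs only a multiple of c, so the L_{a,b}(m,n) and the multiples of c that
lie in 𝔏 span 𝔏. -/
theorem quadSpace_induction {C : quadSpace B hB → Prop} (hquad : ∀ a b m n, C (quad B hB a b m n))
    (hcen : ∀ (s : ℂ) (x : quadSpace B hB), (x : UH B hB) = s • central B hB → C x)
    (hadd : ∀ x y, C x → C y → C (x + y)) (hsmul : ∀ (s : ℂ) x, C x → C (s • x))
    (x : quadSpace B hB) : C x := by
  obtain ⟨x, hx⟩ := x
  induction hx using Submodule.span_induction with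
  | mem x hx =>
    obtain ⟨a, b, m, n, rfl⟩ := id hx
    have key := osc_mul_osc_eq_quadElt B hB a b m n
    set t : ℂ := if n ≤ m then oscPair B a b m n else 0
    -- The correction is a difference of two elements of 𝔏, so it lies in 𝔏 whether or not c does.
    have hmem : t • central B hB ∈ quadSpace B hB := by
      rw [← sub_eq_iff_eq_add'] at key
      rw [← key]
      exact Submodule.sub_mem _ (Submodule.subset_span hx)
        (Submodule.smul_mem _ _ (quadElt_mem B hB a b m n))
    have h0 : (⟨_, Submodule.subset_span hx⟩ : quadSpace B hB) =
        (2 : ℂ) • quad B hB a b m n + ⟨_, hmem⟩ := Subtype.ext key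
    rw [h0]
    exact hadd _ _ (hsmul _ _ (hquad a b m n)) (hcen t _ rfl)
  | zero => exact hcen 0 _ (zero_smul _ _).symm
  | add x y hx hy ihx ihy => exact hadd ⟨x, hx⟩ ⟨y, hy⟩ ihx ihy
  | smul t x hx ih => exact hsmul t ⟨x, hx⟩ ih

variable (r : ℂ)

theorem toMr_surjective (v : Mr B hB r) : ∃ u, toMr B hB r u = v :=
  Submodule.mkQ_surjective (vacIdeal B hB r) v

theorem smul_vac (u : UL B hB) : u • vac B hB r = toMr B hB r u := by
  rw [vac, ← map_smul, smul_eq_mul, mul_one]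

theorem toMr_eq_zero (u : UL B hB) : toMr B hB r u = 0 ↔ u ∈ vacIdeal B hB r :=
  Submodule.Quotient.mk_eq_zero _

/-- Since c commutes with U(𝔏), (c - r) u = u (c - r) lies in the left ideal. For s = 0 the element
c itself may be missing from 𝔏, hence the separate case. -/
theorem toUL_central_smul (x : quadSpace B hB) (s : ℂ) (hx : (x : UH B hB) = s • central B hB)
    (v : Mr B hB r) : toUL B hB x • v = (s * r) • v := by
  by_cases hs : s = 0
  · have : x = 0 := Subtype.ext (by rw [hx, hs, zero_smul]; rfl)
    rw [this, map_zero, hs, zero_smul, zero_mul, zero_smul]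
  · have hc : central B hB ∈ quadSpace B hB := by
      have := Submodule.smul_mem _ s⁻¹ x.2
      rwa [hx, smul_smul, inv_mul_cancel₀ hs, one_smul] at this
    obtain rfl : x = s • ⟨central B hB, hc⟩ := Subtype.ext hx
    rw [map_smul, smul_assoc, mul_smul]
    congr 1
    obtain ⟨u, rfl⟩ := toMr_surjective B hB r v
    rw [← map_smul, ← algebraMap_smul (UL B hB) r (toMr B hB r u), ← map_smul, ← sub_eq_zero,
      ← map_sub, toMr_eq_zero, smul_eq_mul, smul_eq_mul, toUL_central_comm B hB _ rfl,
      Algebra.commutes r u, ← mul_sub]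
    exact Submodule.smul_mem _ u (Submodule.subset_span (Or.inr ⟨_, rfl, rfl⟩))

theorem toUL_pos_vac (x : quadSpace B hB) (hx : (x : UH B hB) ∈ posSpace B hB) :
    toUL B hB x • vac B hB r = 0 := by
  rw [smul_vac, toMr_eq_zero]
  exact Submodule.subset_span (Or.inl ⟨x, hx, rfl⟩)

/-- The vectors `L_{a_1,b_1}(m_1,n_1) ⋯ L_{a_s,b_s}(m_s,n_s) 1` with all `m_i`, `n_i` negative. -/
inductive NegWord : ℕ → Mr B hB r → Prop
  | vac : NegWord 0 (vac B hB r)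
  | cons {s : ℕ} {v : Mr B hB r} (a b : 𝔥) (m n : ℤ) (hm : m < 0) (hn : n < 0)
      (hv : NegWord s v) : NegWord (s + 1) (toUL B hB (quad B hB a b m n) • v)

/-- The span of the products of at most `s` elements `L_{a,b}(m,n)`, `m, n < 0`, applied to `1`. -/
def negSpan (s : ℕ) : Submodule ℂ (Mr B hB r) :=
  Submodule.span ℂ {v | ∃ t ≤ s, NegWord B hB r t v}

variable {B hB r}

theorem negSpan_mono {s t : ℕ} (h : s ≤ t) : negSpan B hB r s ≤ negSpan B hB r t :=
  Submodule.span_mono fun _ ⟨u, hu, hv⟩ => ⟨u, hu.trans h, hv⟩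

theorem smul_negSpan_neg {s : ℕ} (a b : 𝔥) (m n : ℤ) (hm : m < 0) (hn : n < 0)
    {v : Mr B hB r} (hv : v ∈ negSpan B hB r s) :
    toUL B hB (quad B hB a b m n) • v ∈ negSpan B hB r (s + 1) := by
  induction hv using Submodule.span_induction with
  | mem v hv =>
    obtain ⟨t, ht, hv⟩ := hv
    exact Submodule.subset_span ⟨t + 1, by omega, hv.cons a b m n hm hn⟩
  | zero => rw [smul_zero]; exact Submodule.zero_mem _
  | add v w _ _ hv hw => rw [smul_add]; exact Submodule.add_mem _ hv hw
  | smul c v _ hv => rw [smul_comm]; exact Submodule.smul_mem _ c hv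

theorem smul_mem_of_quad {w : Mr B hB r} {W : Submodule ℂ (Mr B hB r)}
    (hW : w ∈ W) (h : ∀ a b m n, toUL B hB (quad B hB a b m n) • w ∈ W)
    (x : quadSpace B hB) : toUL B hB x • w ∈ W := by
  induction x using quadSpace_induction with
  | hquad a b m n => exact h a b m n
  | hcen s x hx =>
    rw [toUL_central_smul B hB r x s hx]
    exact Submodule.smul_mem _ _ hW
  | hadd x y hx hy =>
    rw [map_add, add_smul]
    exact Submodule.add_mem _ hx hy
  | hsmul s x hx =>
    rw [map_smul, smul_assoc]
    exact Submodule.smul_mem _ s hx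

/-- Induction on the length. Moving an element of 𝔅₊ past the first letter leaves a bracket in 𝔏,
acting on a word shorter by one; by induction it lengthens that word by at most one, so the original
length is not exceeded. -/
theorem quad_smul_negWord {s : ℕ} {v : Mr B hB r} (hv : NegWord B hB r s v) :
    (∀ (a b : 𝔥) (m n : ℤ), (0 ≤ m ∨ 0 ≤ n) →
      toUL B hB (quad B hB a b m n) • v ∈ negSpan B hB r s) ∧
    ∀ x : quadSpace B hB, toUL B hB x • v ∈ negSpan B hB r (s + 1) := by
  suffices h : ∀ (a b : 𝔥) (m n : ℤ), (0 ≤ m ∨ 0 ≤ n) →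
      toUL B hB (quad B hB a b m n) • v ∈ negSpan B hB r s by
    refine ⟨h, fun x => smul_mem_of_quad ?_ ?_ x⟩
    · exact Submodule.subset_span ⟨s, by omega, hv⟩
    · intro a b m n
      by_cases hmn : 0 ≤ m ∨ 0 ≤ n
      · exact negSpan_mono (by omega) (h a b m n hmn)
      · exact smul_negSpan_neg a b m n (by omega) (by omega) (Submodule.subset_span ⟨s, le_rfl, hv⟩)
  induction hv with
  | vac =>
    intro a b m n hmn
    rw [toUL_pos_vac B hB r _ (Submodule.subset_span ⟨a, b, m, n, hmn, rfl⟩)]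
    exact Submodule.zero_mem _
  | @cons s v u w p q hp hq hv ih =>
    intro a b m n hmn
    have hall : ∀ x : quadSpace B hB, toUL B hB x • v ∈ negSpan B hB r (s + 1) := by
      refine fun x => smul_mem_of_quad ?_ ?_ x
      · exact Submodule.subset_span ⟨s, by omega, hv⟩
      · intro a b m n
        by_cases hmn : 0 ≤ m ∨ 0 ≤ n
        · exact negSpan_mono (by omega) (ih a b m n hmn)
        · exact smul_negSpan_neg a b m n (by omega) (by omega)
            (Submodule.subset_span ⟨s, le_rfl, hv⟩)
    obtain ⟨z, hz⟩ : ∃ z : quadSpace B hB, quadElt B hB a b m n * quadElt B hB u w p q =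
        quadElt B hB u w p q * quadElt B hB a b m n + central B hB * (z : UH B hB) := by
      have hz : ∀ (u w : 𝔥) (p q : ℤ), ∃ z : quadSpace B hB,
          quadElt B hB a b m n * ((1 / 2 : ℂ) • (osc B hB u p * osc B hB w q)) =
          (1 / 2 : ℂ) • (osc B hB u p * osc B hB w q) * quadElt B hB a b m n +
            central B hB * (z : UH B hB) := fun u w p q =>
        ⟨⟨_, Submodule.smul_mem _ (1 / 2 : ℂ) (quadAd_mem B hB a b m n u w p q)⟩, by
          rw [mul_smul_comm, quadElt_mul_osc_osc, smul_add, smul_mul_assoc, mul_smul_comm]⟩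
      by_cases hqp : q ≤ p
      · have := hz w u q p
        simpa only [quadElt, if_pos hqp] using this
      · have := hz u w p q
        simpa only [quadElt, if_neg hqp] using this
    rw [toUL_smul_smul B hB r (quad B hB a b m n) (quad B hB u w p q) z hz]
    exact Submodule.add_mem _ (smul_negSpan_neg u w p q hp hq (ih a b m n hmn)) (hall z)

/-- The spanning half of a Poincaré–Birkhoff–Witt statement; linear independence is not needed. -/
theorem iSup_negSpan (v : Mr B hB r) : ∃ s, v ∈ negSpan B hB r s := by
  have hx : ∀ (x : quadSpace B hB) (s : ℕ) (v : Mr B hB r), v ∈ negSpan B hB r s →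
      toUL B hB x • v ∈ negSpan B hB r (s + 1) := by
    intro x s v hv
    induction hv using Submodule.span_induction with
    | mem v hv =>
      obtain ⟨t, ht, hv⟩ := hv
      exact negSpan_mono (by omega) ((quad_smul_negWord hv).2 x)
    | zero => rw [smul_zero]; exact Submodule.zero_mem _
    | add v w _ _ hv hw => rw [smul_add]; exact Submodule.add_mem _ hv hw
    | smul c v _ hv => rw [smul_comm]; exact Submodule.smul_mem _ c hv
  have key : ∀ (u : UL B hB) (s : ℕ) (v : Mr B hB r), v ∈ negSpan B hB r s →
      ∃ t, u • v ∈ negSpan B hB r t := by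
    intro u
    induction u using UL_induction with
    | hal c => exact fun s v hv => ⟨s, by rw [algebraMap_smul]; exact Submodule.smul_mem _ c hv⟩
    | hι x => exact fun s v hv => ⟨_, hx x s v hv⟩
    | hmul u v hu hv =>
      intro s w hw
      obtain ⟨t, ht⟩ := hv s w hw
      obtain ⟨t', ht'⟩ := hu t _ ht
      exact ⟨t', by rwa [mul_smul]⟩
    | hadd u v hu hv =>
      intro s w hw
      obtain ⟨t, ht⟩ := hu s w hw
      obtain ⟨t', ht'⟩ := hv s w hw
      refine ⟨max t t', ?_⟩
      rw [add_smul]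
      exact Submodule.add_mem _ (negSpan_mono (le_max_left _ _) ht)
        (negSpan_mono (le_max_right _ _) ht')
  obtain ⟨u, rfl⟩ := toMr_surjective B hB r v
  rw [← smul_vac]
  exact key u 0 _ (Submodule.subset_span ⟨0, le_rfl, NegWord.vac⟩)

variable (B hB r)

/-! ### The grading of M_r by ω(1) and the uniqueness of 1'. -/

section Conformal

variable [FiniteDimensional ℂ 𝔥] (hN : B.Nondegenerate)

theorem conformalTerm_smul (k : ℤ) (v : Mr B hB r) :
    toUL B hB ⟨conformalTerm B hB hN k, conformalTerm_mem B hB hN k⟩ • v =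
      ∑ i, act B hB r (Module.finBasis ℂ 𝔥 i)
        (B.dualBasis hN (Module.finBasis ℂ 𝔥) i) (-k + 1 - 1) k v := by
  simp only [act_apply, add_sub_cancel_right]
  rw [← Finset.sum_smul, ← map_sum]
  congr 2
  ext
  simp [conformalTerm]

theorem support_conformalTerm (v : Mr B hB r) :
    (Function.support fun k : ℤ =>
      toUL B hB ⟨conformalTerm B hB hN k, conformalTerm_mem B hB hN k⟩ • v).Finite := by
  refine (Set.finite_iUnion fun i => locFin v (Module.finBasis ℂ 𝔥 i)
    (B.dualBasis hN (Module.finBasis ℂ 𝔥) i) 1).subset fun k hk => ?_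
  rw [Function.mem_support, conformalTerm_smul] at hk
  obtain ⟨i, _, hi⟩ := Finset.exists_ne_zero_of_sum_ne_zero hk
  exact Set.mem_iUnion.2 ⟨i, hi⟩

theorem conformalOp_apply (v : Mr B hB r) :
    conformalOp B hB r hN v = ∑ᶠ k : ℤ,
      toUL B hB ⟨conformalTerm B hB hN k, conformalTerm_mem B hB hN k⟩ • v := by
  rw [finsum_congr fun k => conformalTerm_smul B hB r hN k v, finsum_sum_comm]
  · simp only [conformalOp, LinearMap.sum_apply]
    rfl
  · exact fun i _ => locFin v _ _ 1

/-- Each summand of ω(1) scales y under the bracket; the scalars sum over k to -(m + n). -/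
theorem conformalOp_smul (y : quadSpace B hB) (m n : ℤ)
    (hy : ∀ k, conformalTerm B hB hN k * (y : UH B hB) =
      (y : UH B hB) * conformalTerm B hB hN k +
        central B hB * ((conformalEigen k m + conformalEigen k n) • (y : UH B hB)))
    (v : Mr B hB r) :
    conformalOp B hB r hN (toUL B hB y • v) =
      toUL B hB y • conformalOp B hB r hN v - ((m : ℂ) + n) • toUL B hB y • v := by
  rw [conformalOp_apply, conformalOp_apply]
  have h : ∀ k : ℤ, toUL B hB ⟨conformalTerm B hB hN k, conformalTerm_mem B hB hN k⟩ •
      toUL B hB y • v = toUL B hB y • toUL B hB ⟨conformalTerm B hB hN k,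
        conformalTerm_mem B hB hN k⟩ • v +
        (conformalEigen k m + conformalEigen k n) • toUL B hB y • v := by
    intro k
    rw [toUL_smul_smul B hB r _ y ((conformalEigen k m + conformalEigen k n) • y) (hy k),
      map_smul, smul_assoc]
  have hfin : ∀ p : ℤ, (Function.support fun k => conformalEigen k p).Finite := fun p =>
    (Finset.finite_toSet _).subset (support_conformalEigen p)
  have hsum : (Function.support fun k => conformalEigen k m + conformalEigen k n).Finite :=
    ((hfin m).union (hfin n)).subset (Function.support_add _ _)
  rw [finsum_congr h, finsum_add_distrib, smul_finsum' _ (support_conformalTerm B hB r hN v),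
    ← finsum_smul' hsum, finsum_add_distrib (hfin m) (hfin n), finsum_conformalEigen,
    finsum_conformalEigen, sub_eq_add_neg, ← neg_smul]
  · congr 2
    ring
  · refine (support_conformalTerm B hB r hN v).subset fun k hk hc => hk ?_
    simp only [] at hc
    simp [hc]
  · refine hsum.subset fun k hk hc => hk ?_
    simp only [] at hc
    simp [hc]

theorem conformalOp_act (a b : 𝔥) (m n : ℤ) (v : Mr B hB r) :
    conformalOp B hB r hN (act B hB r a b m n v) =
      act B hB r a b m n (conformalOp B hB r hN v) - ((m : ℂ) + n) • act B hB r a b m n v :=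
  conformalOp_smul B hB r hN _ m n (fun k => conformalTerm_mul_quadElt B hB hN k a b m n) v

theorem conformalOp_vac : conformalOp B hB r hN (vac B hB r) = 0 := by
  rw [conformalOp_apply, ← finsum_zero (α := ℤ)]
  refine finsum_congr fun k => toUL_pos_vac B hB r _ ?_
  change conformalTerm B hB hN k ∈ _
  refine Submodule.sum_mem _ fun i _ => Submodule.subset_span ⟨_, _, _, _, ?_, rfl⟩
  omega

theorem conformalOp_mode (a b : 𝔥) (l : ℤ) (v : Mr B hB r) (c : ℂ)
    (hv : conformalOp B hB r hN v = c • v) :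
    conformalOp B hB r hN (mode B hB r a b l v) = (c + 1 - l) • mode B hB r a b l v := by
  have hfin := locFin v a b l
  change conformalOp B hB r hN (∑ᶠ k : ℤ, act B hB r a b (-k + l - 1) k v) =
    _ • ∑ᶠ k : ℤ, act B hB r a b (-k + l - 1) k v
  rw [smul_finsum' _ hfin,
    ← LinearMap.toAddMonoidHom_coe, AddMonoidHom.map_finsum _ hfin]
  refine finsum_congr fun k => ?_
  rw [LinearMap.toAddMonoidHom_coe, conformalOp_act, hv, map_smul, ← sub_smul]
  congr 1
  push_cast
  ring

theorem conformalOp_modeWord {n : ℕ} (a b : Fin n → 𝔥) (m : Fin n → ℤ) :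
    ∃ k : ℤ, conformalOp B hB r hN (modeWord B hB r a b m) = (k : ℂ) • modeWord B hB r a b m := by
  induction n with
  | zero => exact ⟨0, by simp [modeWord, conformalOp_vac]⟩
  | succ n ih =>
    obtain ⟨k, hk⟩ := ih (fun i => a i.succ) (fun i => b i.succ) (fun i => m i.succ)
    refine ⟨k + 1 - m 0, ?_⟩
    have h : modeWord B hB r a b m = mode B hB r (a 0) (b 0) (m 0)
        (modeWord B hB r (fun i => a i.succ) (fun i => b i.succ) fun i => m i.succ) := by
      simp [modeWord, List.ofFn_succ]
    rw [h, conformalOp_mode B hB r hN _ _ _ _ _ hk]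
    push_cast
    rfl

/-- Every letter raises the weight by -(m + n), which is at least 2. -/
theorem negWord_eigen {s : ℕ} {v : Mr B hB r} (hv : NegWord B hB r s v) :
    (v = vac B hB r ∧ s = 0) ∨
      ∃ k : ℕ, 1 ≤ k ∧ conformalOp B hB r hN v = (k : ℂ) • v := by
  induction hv with
  | vac => exact Or.inl ⟨rfl, rfl⟩
  | @cons s v a b m n hm hn hv ih =>
    right
    obtain ⟨k, hk⟩ : ∃ k : ℕ, conformalOp B hB r hN v = (k : ℂ) • v := by
      rcases ih with ⟨rfl, -⟩ | ⟨k, -, hk⟩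
      · exact ⟨0, by simp [conformalOp_vac]⟩
      · exact ⟨k, hk⟩
    obtain ⟨m', rfl⟩ := Int.eq_negSucc_of_lt_zero hm
    obtain ⟨n', rfl⟩ := Int.eq_negSucc_of_lt_zero hn
    refine ⟨k + (m' + 1) + (n' + 1), by omega, ?_⟩
    have := conformalOp_act B hB r hN a b (Int.negSucc m') (Int.negSucc n') v
    rw [hk, map_smul, ← sub_smul] at this
    refine this.trans ?_
    rw [act_apply]
    congr 1
    push_cast [Int.negSucc_eq]
    ring

/-- By the spanning words, v is a multiple of the vacuum modulo the positive eigenspaces P. The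
difference also lies in the sum Q of the eigenspaces for integers at most 0, and P ∩ Q = 0 by
independence of eigenspaces. -/
theorem mem_span_vac_of_eigen (v : Mr B hB r) (k : ℤ) (hk : k ≤ 0)
    (hv : conformalOp B hB r hN v = (k : ℂ) • v) : ∃ c : ℂ, v = c • vac B hB r := by
  set P : Submodule ℂ (Mr B hB r) :=
    ⨆ μ ∈ {μ : ℂ | ∃ j : ℕ, 1 ≤ j ∧ μ = j}, (conformalOp B hB r hN).eigenspace μ with hP
  set Q : Submodule ℂ (Mr B hB r) :=
    ⨆ μ ∈ {μ : ℂ | ∃ j : ℤ, j ≤ 0 ∧ μ = j}, (conformalOp B hB r hN).eigenspace μ with hQ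
  have hdisj : Disjoint P Q := by
    refine (Module.End.eigenspaces_iSupIndep (conformalOp B hB r hN)).disjoint_biSup_biSup ?_
    rw [Set.disjoint_left]
    rintro _ ⟨j, hj, rfl⟩ ⟨i, hi, h⟩
    have : (j : ℤ) = i := by exact_mod_cast h
    omega
  have hdec : ∀ w : Mr B hB r, ∃ c : ℂ, w - c • vac B hB r ∈ P := by
    intro w
    obtain ⟨s, hs⟩ := iSup_negSpan w
    induction hs using Submodule.span_induction with
    | mem w hw =>
      obtain ⟨t, -, hw⟩ := hw
      rcases negWord_eigen B hB r hN hw with ⟨rfl, -⟩ | ⟨j, hj, h⟩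
      · exact ⟨1, by simp⟩
      · refine ⟨0, ?_⟩
        rw [zero_smul, sub_zero]
        exact Submodule.mem_iSup_of_mem (j : ℂ) (Submodule.mem_iSup_of_mem ⟨j, hj, rfl⟩
          (Module.End.mem_eigenspace_iff.2 h))
    | zero => exact ⟨0, by simp⟩
    | add x y _ _ hx hy =>
      obtain ⟨c, hc⟩ := hx
      obtain ⟨d, hd⟩ := hy
      refine ⟨c + d, ?_⟩
      convert Submodule.add_mem _ hc hd using 1
      rw [add_smul]
      abel
    | smul t x _ hx =>
      obtain ⟨c, hc⟩ := hx
      refine ⟨t * c, ?_⟩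
      convert Submodule.smul_mem _ t hc using 1
      rw [smul_sub, mul_smul]
  obtain ⟨c, hc⟩ := hdec v
  refine ⟨c, sub_eq_zero.1 (Submodule.disjoint_def.1 hdisj _ hc ?_)⟩
  refine Submodule.sub_mem _ ?_ (Submodule.smul_mem _ c ?_)
  · exact Submodule.mem_iSup_of_mem (k : ℂ) (Submodule.mem_iSup_of_mem ⟨k, hk, rfl⟩
      (Module.End.mem_eigenspace_iff.2 hv))
  · refine Submodule.mem_iSup_of_mem (0 : ℂ) (Submodule.mem_iSup_of_mem ⟨0, le_rfl, by simp⟩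
      (Module.End.mem_eigenspace_iff.2 ?_))
    rw [conformalOp_vac, zero_smul]

/-- A vacuum functional is determined by any functional on `M_r` with value `1` at the vacuum that
kills the image of `ω(1)`. -/
theorem isVacuumFunctional_iff (F : Module.Dual ℂ (Mr B hB r)) (h1 : F (vac B hB r) = 1)
    (h0 : ∀ v, F (conformalOp B hB r hN v) = 0) (φ : Module.Dual ℂ (V B hB r)) :
    IsVacuumFunctional B hB r hN φ ↔ φ = F.comp (V B hB r).subtype := by
  have hF : ∀ (v : Mr B hB r) (μ : ℂ), μ ≠ 0 → conformalOp B hB r hN v = μ • v → F v = 0 := by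
    intro v μ hμ hv
    have := h0 v
    rw [hv, map_smul, smul_eq_mul] at this
    exact (mul_eq_zero.1 this).resolve_left hμ
  constructor
  · rintro ⟨hvac, hφ⟩
    have hword : ∀ (n : ℕ) (a b : Fin n → 𝔥) (m : Fin n → ℤ),
        φ (wordV B hB r a b m) = F (modeWord B hB r a b m) := by
      intro n a b m
      obtain ⟨k, hk⟩ := conformalOp_modeWord B hB r hN a b m
      -- A vacuum functional is prescribed only at the vacuum and at positive weights; words of
      -- weight at most 0 are multiples of the vacuum.
      by_cases hk0 : k ≤ 0
      · obtain ⟨c, hc⟩ := mem_span_vac_of_eigen B hB r hN _ k hk0 hk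
        have : wordV B hB r a b m = c • vacV B hB r := Subtype.ext hc
        rw [this, hc, map_smul, map_smul, hvac, h1]
      · obtain ⟨j, rfl⟩ := Int.eq_ofNat_of_zero_le (not_le.1 hk0).le
        rw [hφ j (by omega) _ (Module.End.mem_eigenspace_iff.2 (by exact_mod_cast hk)),
          hF _ _ (by exact_mod_cast (not_le.1 hk0).ne') hk]
    ext ⟨v, hv⟩
    induction hv using Submodule.span_induction with
    | mem v hv =>
      obtain ⟨n, a, b, m, rfl⟩ := hv
      exact hword n a b m
    | zero => exact (map_zero φ).trans (map_zero F).symm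
    | add x y hx hy ihx ihy =>
      have h : (⟨x + y, Submodule.add_mem _ hx hy⟩ : V B hB r) = ⟨x, hx⟩ + ⟨y, hy⟩ := rfl
      rw [h, map_add, map_add, ihx, ihy]
    | smul t x hx ih =>
      have h : (⟨t • x, Submodule.smul_mem _ t hx⟩ : V B hB r) = t • ⟨x, hx⟩ := rfl
      rw [h, map_smul, map_smul, ih]
  · rintro rfl
    refine ⟨h1, fun k hk v hv => ?_⟩
    exact hF _ _ (by exact_mod_cast (by omega : k ≠ 0)) (Module.End.mem_eigenspace_iff.1 hv)

end Conformal

end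

end JordanVOA

namespace JordanVOA

open TensorProduct

noncomputable section

variable {𝔥 : Type*} [AddCommGroup 𝔥] [Module ℂ 𝔥]
variable (B : LinearMap.BilinForm ℂ 𝔥) (hB : B.IsSymm) (N : ℕ)

/-! ### The Fock space of `N` complex bosons -/

/-- The flavours of `N` complex bosons: `(α, false)` and `(α, true)` are conjugate. -/
abbrev Flavour : Type := Fin N × Bool

/-- The conjugate flavour. -/
def Flavour.conj {N : ℕ} (p : Flavour N) : Flavour N := (p.1, !p.2)

variable (𝔥) in
/-- The Fock space, polynomials in the creation operators. -/
abbrev Fock : Type := MvPolynomial (Flavour N × Fin (Module.finrank ℂ 𝔥) × ℤ) ℂ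

/-- The projection of `𝔥 ⊗ ℂ[t, t⁻¹]` onto the part of negative degree. -/
def negPart : (ℤ →₀ 𝔥) →ₗ[ℂ] (ℤ →₀ 𝔥) :=
  Finsupp.lsum ℂ fun m : ℤ => if m < 0 then Finsupp.lsingle m else 0

theorem negPart_single (m : ℤ) (a : 𝔥) :
    negPart (Finsupp.single m a) = if m < 0 then Finsupp.single m a else 0 := by
  simp only [negPart, Finsupp.lsum_single]
  split_ifs <;> simp

/-- The pairing of f with the negative part of g is the vacuum contraction; its antisymmetrisation
is the full bracket, the zero mode being harmless because of the factor m. -/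
theorem cocycle_negPart_sub (hB : B.IsSymm) (f g : ℤ →₀ 𝔥) :
    cocycle B f (negPart g) - cocycle B g (negPart f) = cocycle B f g := by
  induction f using Finsupp.induction_linear with
  | zero => simp
  | add f₁ f₂ h₁ h₂ =>
    simp only [map_add, LinearMap.add_apply, ← h₁, ← h₂]
    ring
  | single m a =>
    induction g using Finsupp.induction_linear with
    | zero => simp
    | add f₁ f₂ h₁ h₂ =>
      simp only [map_add, LinearMap.add_apply, ← h₁, ← h₂]
      ring
    | single n b =>
      rw [negPart_single, negPart_single, apply_ite (cocycle B _), apply_ite (cocycle B _),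
        cocycle_single, cocycle_single, map_zero, map_zero, add_comm n m, hB.eq b a]
      rcases lt_trichotomy m 0 with h | h | h
      · rw [if_pos h]
        by_cases h' : m + n = 0
        · obtain rfl : n = -m := by omega
          simp [show ¬ (0 < m) by omega]
        · simp [h']
      · subst h
        by_cases h' : n = 0 <;> simp [h']
      · rw [if_neg (by omega : ¬ m < 0)]
        by_cases h' : m + n = 0
        · simp [show n < 0 by omega]
        · simp [h']

/-- The vacuum expectation value of an operator on the Fock space. -/
def vev : Module.End ℂ (Fock 𝔥 N) →ₗ[ℂ] ℂ :=
  (MvPolynomial.lcoeff ℂ 0) ∘ₗ LinearMap.applyₗ (1 : Fock 𝔥 N)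

theorem vev_apply (T : Module.End ℂ (Fock 𝔥 N)) : vev N T = MvPolynomial.constantCoeff (T 1) := rfl

theorem vev_one : vev N (1 : Module.End ℂ (Fock 𝔥 N)) = 1 := by
  simp [vev_apply]

variable [FiniteDimensional ℂ 𝔥]

/-- The polynomial by which the creation part of `φ_p(f)` multiplies. -/
def creationPoly (p : Flavour N) : (ℤ →₀ 𝔥) →ₗ[ℂ] Fock 𝔥 N :=
  Finsupp.lsum ℂ fun m : ℤ => if m < 0 then
    ∑ i, ((Module.finBasis ℂ 𝔥).coord i).smulRight (MvPolynomial.X (p, i, m)) else 0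

/-- The creation part of the field `φ_p(f)`. -/
def creation (p : Flavour N) : (ℤ →₀ 𝔥) →ₗ[ℂ] Module.End ℂ (Fock 𝔥 N) :=
  LinearMap.mul ℂ (Fock 𝔥 N) ∘ₗ creationPoly N p

/-- The derivation giving the annihilation part of the field `φ_p(f)`. -/
def annihilationDer (p : Flavour N) (f : ℤ →₀ 𝔥) : Derivation ℂ (Fock 𝔥 N) (Fock 𝔥 N) :=
  MvPolynomial.mkDerivation ℂ fun s => if s.1 = p.conj ∧ s.2.2 < 0 then
    MvPolynomial.C (cocycle B f (Finsupp.single s.2.2 (Module.finBasis ℂ 𝔥 s.2.1))) else 0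

/-- The annihilation part of the field `φ_p(f)`. -/
def annihilation (p : Flavour N) : (ℤ →₀ 𝔥) →ₗ[ℂ] Module.End ℂ (Fock 𝔥 N) where
  toFun f := (annihilationDer B N p f).toLinearMap
  map_add' f g := by
    have : annihilationDer B N p (f + g) = annihilationDer B N p f + annihilationDer B N p g := by
      refine MvPolynomial.derivation_ext fun s => ?_
      simp only [annihilationDer, MvPolynomial.mkDerivation_X, Derivation.add_apply]
      split_ifs <;> simp
    rw [this]
    rfl
  map_smul' t f := by
    have : annihilationDer B N p (t • f) = t • annihilationDer B N p f := by
      refine MvPolynomial.derivation_ext fun s => ?_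
      simp only [annihilationDer, MvPolynomial.mkDerivation_X, Derivation.smul_apply]
      split_ifs <;> simp [MvPolynomial.smul_eq_C_mul]
    rw [this]
    rfl

theorem creation_apply (p : Flavour N) (f : ℤ →₀ 𝔥) (v : Fock 𝔥 N) :
    creation N p f v = creationPoly N p f * v := rfl

theorem annihilation_apply (p : Flavour N) (f : ℤ →₀ 𝔥) (v : Fock 𝔥 N) :
    annihilation B N p f v = annihilationDer B N p f v := rfl

theorem creation_comm (p q : Flavour N) (f g : ℤ →₀ 𝔥) :
    creation N p f * creation N q g = creation N q g * creation N p f := by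
  refine LinearMap.ext fun v => ?_
  simp only [Module.End.mul_apply, creation_apply]
  ring

/-- Both are derivations with constant values on the variables, so their commutator is a derivation
that vanishes on generators. -/
theorem annihilation_comm (p q : Flavour N) (f g : ℤ →₀ 𝔥) :
    annihilation B N p f * annihilation B N q g = annihilation B N q g * annihilation B N p f := by
  have h : ⁅annihilationDer B N p f, annihilationDer B N q g⁆ = 0 := by
    refine MvPolynomial.derivation_ext fun s => ?_
    rw [Derivation.commutator_apply]
    simp only [annihilationDer, MvPolynomial.mkDerivation_X]
    split_ifs <;> simp
  refine LinearMap.ext fun v => ?_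
  have := DFunLike.congr_fun h v
  rw [Derivation.commutator_apply, Derivation.zero_apply, sub_eq_zero] at this
  exact this

theorem annihilationDer_creationPoly (p q : Flavour N) (f g : ℤ →₀ 𝔥) :
    annihilationDer B N p f (creationPoly N q g) =
      MvPolynomial.C (if q = p.conj then cocycle B f (negPart g) else 0) := by
  induction g using Finsupp.induction_linear with
  | zero => simp
  | add g₁ g₂ h₁ h₂ =>
    rw [map_add, map_add, h₁, h₂, map_add, map_add, ← map_add]
    congr 1
    split_ifs <;> simp
  | single m b =>
    rw [negPart_single]
    simp only [creationPoly, Finsupp.lsum_single]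
    split_ifs with hm hq hq
    · simp only [LinearMap.sum_apply, LinearMap.smulRight_apply, map_sum, Derivation.map_smul]
      conv_rhs => rw [← (Module.finBasis ℂ 𝔥).sum_repr b]
      rw [Finsupp.single_finsetSum, map_sum, map_sum]
      refine Finset.sum_congr rfl fun i _ => ?_
      rw [annihilationDer, MvPolynomial.mkDerivation_X, if_pos ⟨hq, hm⟩, ← Finsupp.smul_single,
        map_smul, MvPolynomial.smul_eq_C_mul, smul_eq_mul, map_mul]
      rfl
    · simp only [LinearMap.sum_apply, LinearMap.smulRight_apply, map_sum, Derivation.map_smul]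
      rw [map_zero]
      refine Finset.sum_eq_zero fun i _ => ?_
      rw [annihilationDer, MvPolynomial.mkDerivation_X, if_neg (fun h => hq h.1), smul_zero]
    · simp
    · simp

theorem annihilation_creation (p q : Flavour N) (f g : ℤ →₀ 𝔥) :
    annihilation B N p f * creation N q g = creation N q g * annihilation B N p f +
      (if q = p.conj then cocycle B f (negPart g) else 0) • 1 := by
  refine LinearMap.ext fun v => ?_
  simp only [Module.End.mul_apply, creation_apply, annihilation_apply, LinearMap.add_apply,
    LinearMap.smul_apply, Module.End.one_apply]
  rw [Derivation.leibniz, annihilationDer_creationPoly, smul_eq_mul, smul_eq_mul,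
    MvPolynomial.smul_eq_C_mul, mul_comm v]

/-- The field `φ_p(f)`. -/
def field (p : Flavour N) : (ℤ →₀ 𝔥) →ₗ[ℂ] Module.End ℂ (Fock 𝔥 N) :=
  creation N p + annihilation B N p

theorem Flavour.conj_conj {N : ℕ} (p : Flavour N) : p.conj.conj = p := by
  simp [Flavour.conj]

theorem field_mul_creation (p q : Flavour N) (f g : ℤ →₀ 𝔥) :
    field B N p f * creation N q g = creation N q g * field B N p f +
      (if q = p.conj then cocycle B f (negPart g) else 0) • 1 := by
  rw [field, LinearMap.add_apply, add_mul, mul_add, annihilation_creation, creation_comm,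
    add_assoc]

theorem annihilation_mul_field (p q : Flavour N) (f g : ℤ →₀ 𝔥) :
    annihilation B N p f * field B N q g = field B N q g * annihilation B N p f +
      (if q = p.conj then cocycle B f (negPart g) else 0) • 1 := by
  rw [field, LinearMap.add_apply, add_mul, mul_add, annihilation_creation, annihilation_comm]
  abel

theorem field_mul_field (hB : B.IsSymm) (p q : Flavour N) (f g : ℤ →₀ 𝔥) :
    field B N p f * field B N q g = field B N q g * field B N p f +
      (if q = p.conj then cocycle B f g else 0) • 1 := by
  have h1 := field_mul_creation B N p q f g
  have h2 := annihilation_comm B N p q f g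
  have h3 := annihilation_creation B N q p g f
  have hpq : p = q.conj ↔ q = p.conj := by
    constructor <;> rintro rfl <;> rw [Flavour.conj_conj]
  have h4 : (if q = p.conj then cocycle B f (negPart g) else 0) -
      (if p = q.conj then cocycle B g (negPart f) else 0) =
      if q = p.conj then cocycle B f g else 0 := by
    simp only [hpq]
    split_ifs
    · exact cocycle_negPart_sub B hB f g
    · simp
  rw [← h4, sub_smul _ _ (1 : Module.End ℂ (Fock 𝔥 N))]
  simp only [field, LinearMap.add_apply, mul_add, add_mul] at h1 ⊢
  rw [h2, h3, h1]
  abel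

/-- The coefficients of the real bosons with respect to the complex ones. -/
def realCoeff : Bool → Bool → ℂ
  | false, false => 1
  | false, true => 1 / 2
  | true, false => Complex.I
  | true, true => -(Complex.I / 2)

/-- The real bosons. -/
def realField (p : Flavour N) : (ℤ →₀ 𝔥) →ₗ[ℂ] Module.End ℂ (Fock 𝔥 N) :=
  realCoeff p.2 false • field B N (p.1, false) + realCoeff p.2 true • field B N (p.1, true)

/-- With φ, φ' conjugate, the real bosons are φ + φ'/2 and i(φ - φ'/2). The bracket pairs φ only
with φ', so each has self-pairing 1, and the mixed terms -i/2 + i/2 cancel. -/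
theorem realField_mul_realField (hB : B.IsSymm) (p q : Flavour N) (f g : ℤ →₀ 𝔥) :
    realField B N p f * realField B N q g = realField B N q g * realField B N p f +
      (if p = q then cocycle B f g else 0) • 1 := by
  obtain ⟨α, x⟩ := p
  obtain ⟨β, y⟩ := q
  have h00 := field_mul_field B N hB (α, false) (β, false) f g
  have h01 := field_mul_field B N hB (α, false) (β, true) f g
  have h10 := field_mul_field B N hB (α, true) (β, false) f g
  have h11 := field_mul_field B N hB (α, true) (β, true) f g
  simp only [realField, LinearMap.add_apply, LinearMap.smul_apply, mul_add, add_mul,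
    smul_mul_smul_comm]
  rw [h00, h01, h10, h11]
  by_cases h : α = β
  · subst h
    simp only [Flavour.conj, Bool.not_false, Bool.not_true, Prod.mk.injEq, true_and, reduceCtorEq,
      if_true, if_false, zero_smul, add_zero]
    have hI : Complex.I * Complex.I = -1 := Complex.I_mul_I
    have h1 : Complex.I * -(Complex.I / 2) = 1 / 2 := by linear_combination (-1 / 2 : ℂ) * hI
    have h2 : -(Complex.I / 2) * Complex.I = 1 / 2 := by linear_combination (-1 / 2 : ℂ) * hI
    cases x <;> cases y <;> simp only [realCoeff, reduceCtorEq, if_true, if_false, h1, h2] <;>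
      module
  · have h' : β ≠ α := fun e => h e.symm
    simp only [Flavour.conj, Bool.not_false, Bool.not_true, Prod.mk.injEq, h, h', false_and,
      if_false, zero_smul, add_zero, mul_comm (realCoeff x _)]
    abel

/-! ### The diagonal representation of 𝔏. -/

/-- The `p`-th of the commuting homomorphisms `U(ĥ) → End(Fock)` of level one. -/
def fockHom (p : Flavour N) : UH B hB →ₐ[ℂ] Module.End ℂ (Fock 𝔥 N) :=
  let _ : LieRing (Module.End ℂ (Fock 𝔥 N)) := LieRing.ofAssociativeRing
  UniversalEnvelopingAlgebra.lift ℂ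
    { toFun := fun x => realField B N p x.1 + x.2 • 1
      map_add' := fun x y => by
        change realField B N p (x.1 + y.1) + (x.2 + y.2) • 1 = _
        rw [map_add, add_smul]
        abel
      map_smul' := fun t x => by
        change realField B N p (t • x.1) + (t * x.2) • 1 = t • (_ + _)
        rw [map_smul, mul_smul, smul_add]
      map_lie' := by
        intro x y
        change realField B N p 0 + cocycle B x.1 y.1 • 1 = _
        rw [map_zero, zero_add, LieRing.of_associative_ring_bracket]
        have := realField_mul_realField B N hB p p x.1 y.1
        rw [if_pos rfl] at this
        simp only [add_mul, mul_add, this, smul_mul_assoc, mul_smul_comm, one_mul, mul_one]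
        module }

theorem fockHom_osc (p : Flavour N) (a : 𝔥) (m : ℤ) :
    fockHom B hB N p (osc B hB a m) = realField B N p (Finsupp.single m a) := by
  refine (UniversalEnvelopingAlgebra.lift_ι_apply' ℂ _ _).trans ?_
  change realField B N p (Finsupp.single m a) + (0 : ℂ) • 1 = _
  rw [zero_smul, add_zero]

theorem fockHom_central (p : Flavour N) : fockHom B hB N p (central B hB) = 1 := by
  refine (UniversalEnvelopingAlgebra.lift_ι_apply' ℂ _ _).trans ?_
  change realField B N p 0 + (1 : ℂ) • 1 = _
  rw [map_zero, one_smul, zero_add]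

theorem fockHom_comm {p q : Flavour N} (hpq : p ≠ q) (x y : UH B hB)
    (hx : x ∈ quadSpace B hB) (hy : y ∈ quadSpace B hB) :
    Commute (fockHom B hB N p x) (fockHom B hB N q y) := by
  have h : ∀ (a b : 𝔥) (m n : ℤ),
      Commute (fockHom B hB N p (osc B hB a m)) (fockHom B hB N q (osc B hB b n)) := by
    intro a b m n
    have := realField_mul_realField B N hB p q (Finsupp.single m a) (Finsupp.single n b)
    rw [if_neg hpq, zero_smul, add_zero] at this
    rw [fockHom_osc, fockHom_osc]
    exact this
  induction hx using Submodule.span_induction with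
  | mem x hx =>
    obtain ⟨a, b, m, n, rfl⟩ := hx
    induction hy using Submodule.span_induction with
    | mem y hy =>
      obtain ⟨a', b', m', n', rfl⟩ := hy
      rw [map_mul, map_mul]
      exact ((h _ _ _ _).mul_right (h _ _ _ _)).mul_left ((h _ _ _ _).mul_right (h _ _ _ _))
    | zero => rw [map_zero]; exact Commute.zero_right _
    | add y z _ _ hy hz => rw [map_add]; exact hy.add_right hz
    | smul t y _ hy => rw [map_smul]; exact hy.smul_right t
  | zero => rw [map_zero]; exact Commute.zero_left _
  | add y z _ _ hy hz => rw [map_add]; exact hy.add_left hz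
  | smul t y _ hy => rw [map_smul]; exact hy.smul_left t

/-- The diagonal action of quadratic elements. -/
def fockSum : UH B hB →ₗ[ℂ] Module.End ℂ (Fock 𝔥 N) :=
  ∑ p, (fockHom B hB N p).toLinearMap

theorem fockSum_apply (x : UH B hB) : fockSum B hB N x = ∑ p, fockHom B hB N p x := by
  simp [fockSum]

theorem fockSum_central : fockSum B hB N (central B hB) = (2 * N : ℂ) • 1 := by
  rw [fockSum_apply]
  simp only [fockHom_central, Finset.sum_const, Finset.card_univ, Fintype.card_prod,
    Fintype.card_fin, Fintype.card_bool]
  rw [← Nat.cast_smul_eq_nsmul ℂ]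
  push_cast
  rw [mul_comm]

/-- Different copies commute, and within one copy c acts by 1, so c w = x y - y x becomes an honest
commutator there. The sum over the copies thus respects the new bracket, although it is not
multiplicative on U(ĥ). -/
theorem fockSum_mul (x y w : quadSpace B hB)
    (h : central B hB * (w : UH B hB) = (x : UH B hB) * y - (y : UH B hB) * x) :
    fockSum B hB N x * fockSum B hB N y =
      fockSum B hB N y * fockSum B hB N x + fockSum B hB N w := by
  have key : ∀ p q, fockHom B hB N p x * fockHom B hB N q y =
      fockHom B hB N q y * fockHom B hB N p x + if q = p then fockHom B hB N p w else 0 := by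
    intro p q
    split_ifs with hpq
    · subst hpq
      have := congrArg (fockHom B hB N q) h
      rw [map_mul, fockHom_central, one_mul, map_sub, map_mul, map_mul] at this
      rw [this]
      abel
    · rw [add_zero]
      exact fockHom_comm B hB N (Ne.symm hpq) x y x.2 y.2
  simp only [fockSum_apply, Finset.sum_mul_sum, key, Finset.sum_add_distrib, Finset.sum_ite_eq',
    Finset.mem_univ, if_true]
  rw [Finset.sum_comm]

/-- The representation of `U(𝔏)` on the Fock space of `N` complex bosons; `c` acts by `2 N`. -/
def fockRep : UL B hB →ₐ[ℂ] Module.End ℂ (Fock 𝔥 N) :=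
  RingQuot.liftAlgHom ℂ (s := EnvRel B hB)
    ⟨TensorAlgebra.lift ℂ (fockSum B hB N ∘ₗ (quadSpace B hB).subtype), by
      rintro _ _ ⟨x, y, w, h⟩
      simp only [map_mul, map_add, TensorAlgebra.lift_ι_apply, LinearMap.comp_apply,
        Submodule.subtype_apply]
      exact fockSum_mul B hB N x y w h⟩

theorem fockRep_toUL (x : quadSpace B hB) : fockRep B hB N (toUL B hB x) = fockSum B hB N x := by
  refine (RingQuot.liftAlgHom_mkAlgHom_apply ℂ _ _ _).trans ?_
  exact TensorAlgebra.lift_ι_apply _ _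

/-- The normally ordered product of the conjugate fields `φ_{α,false}(f)`, `φ_{α,true}(g)`. -/
def normalProd (α : Fin N) (f g : ℤ →₀ 𝔥) : Module.End ℂ (Fock 𝔥 N) :=
  creation N (α, false) f * field B N (α, true) g +
    field B N (α, true) g * annihilation B N (α, false) f

/-- In the sum over the two real bosons of a pair, the terms φφ and φ'φ' cancel and the mixed ones
add up with coefficient 1. -/
theorem fockSum_osc_osc (f g : 𝔥) (m n : ℤ) :
    fockSum B hB N (osc B hB f m * osc B hB g n) =
      ∑ α : Fin N, (field B N (α, false) (Finsupp.single m f) *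
        field B N (α, true) (Finsupp.single n g) +
        field B N (α, true) (Finsupp.single m f) * field B N (α, false) (Finsupp.single n g)) := by
  rw [fockSum_apply, Fintype.sum_prod_type]
  refine Finset.sum_congr rfl fun α _ => ?_
  simp only [map_mul, fockHom_osc, realField, Fintype.sum_bool, LinearMap.add_apply,
    LinearMap.smul_apply, mul_add, add_mul, smul_mul_smul_comm, realCoeff]
  have hI : Complex.I * Complex.I = -1 := Complex.I_mul_I
  have h1 : Complex.I * -(Complex.I / 2) = 1 / 2 := by linear_combination (-1 / 2 : ℂ) * hI
  have h2 : -(Complex.I / 2) * Complex.I = 1 / 2 := by linear_combination (-1 / 2 : ℂ) * hI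
  have h3 : -(Complex.I / 2) * -(Complex.I / 2) = -(1 / 4) := by
    linear_combination (1 / 4 : ℂ) * hI
  rw [hI, h1, h2, h3]
  module

theorem normalProd_of_le (α : Fin N) (a b : 𝔥) {m n : ℤ} (h : n ≤ m) :
    field B N (α, false) (Finsupp.single n b) * field B N (α, true) (Finsupp.single m a) =
      normalProd B N α (Finsupp.single n b) (Finsupp.single m a) ∧
    field B N (α, true) (Finsupp.single n b) * field B N (α, false) (Finsupp.single m a) =
      normalProd B N α (Finsupp.single m a) (Finsupp.single n b) := by
  -- A contraction would require m < 0 and n = -m, against n ≤ m. Hence the ordering in the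
  -- definition of L_{a,b}(m,n) is Fock normal ordering with no constant term.
  have h0 : cocycle B (Finsupp.single n b) (negPart (Finsupp.single m a)) = 0 := by
    rw [negPart_single]
    split_ifs with hm
    · rw [cocycle_single, if_neg (by omega)]
    · exact map_zero _
  constructor
  · have := annihilation_mul_field B N (α, false) (α, true) (Finsupp.single n b)
      (Finsupp.single m a)
    rw [h0, ite_self, zero_smul, add_zero] at this
    rw [normalProd, ← this, ← add_mul]
    rfl
  · have := field_mul_creation B N (α, true) (α, false) (Finsupp.single n b) (Finsupp.single m a)
    rw [h0, ite_self, zero_smul, add_zero] at this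
    rw [normalProd, ← this, ← mul_add]
    rfl

theorem fockSum_quadElt (a b : 𝔥) (m n : ℤ) :
    fockSum B hB N (quadElt B hB a b m n) = (1 / 2 : ℂ) • ∑ α : Fin N,
      (normalProd B N α (Finsupp.single m a) (Finsupp.single n b) +
        normalProd B N α (Finsupp.single n b) (Finsupp.single m a)) := by
  unfold quadElt
  rw [map_smul]
  congr 1
  split_ifs with h
  · rw [fockSum_osc_osc]
    refine Finset.sum_congr rfl fun α _ => ?_
    rw [(normalProd_of_le B N α a b h).1, (normalProd_of_le B N α a b h).2, add_comm]
  · rw [fockSum_osc_osc]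
    refine Finset.sum_congr rfl fun α _ => ?_
    rw [(normalProd_of_le B N α b a (not_le.1 h).le).1,
      (normalProd_of_le B N α b a (not_le.1 h).le).2]

theorem annihilation_one (p : Flavour N) (f : ℤ →₀ 𝔥) :
    annihilation B N p f (1 : Fock 𝔥 N) = 0 :=
  (annihilationDer B N p f).map_one_eq_zero

theorem vev_mul_annihilation (p : Flavour N) (f : ℤ →₀ 𝔥) (T : Module.End ℂ (Fock 𝔥 N)) :
    vev N (T * annihilation B N p f) = 0 := by
  rw [vev_apply, Module.End.mul_apply, annihilation_one, map_zero, map_zero]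

theorem constantCoeff_creationPoly (p : Flavour N) (f : ℤ →₀ 𝔥) :
    MvPolynomial.constantCoeff (creationPoly N p f) = 0 := by
  induction f using Finsupp.induction_linear with
  | zero => simp
  | add f g hf hg => rw [map_add, map_add, hf, hg, add_zero]
  | single m a =>
    simp only [creationPoly, Finsupp.lsum_single]
    split_ifs <;> simp [MvPolynomial.smul_eq_C_mul]

theorem vev_creation_mul (p : Flavour N) (f : ℤ →₀ 𝔥) (T : Module.End ℂ (Fock 𝔥 N)) :
    vev N (creation N p f * T) = 0 := by
  rw [vev_apply, Module.End.mul_apply, creation_apply, map_mul, constantCoeff_creationPoly,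
    zero_mul]

end

end JordanVOA

namespace JordanVOA

noncomputable section

/-! ### Wick's theorem for complex bosons -/

/-- Creation and annihilation parts `cr i`, `an i` of fields `ψ_i`, and fields `bar i` contracting
with them, together with a vacuum functional. -/
structure WickSystem (A : Type*) [Ring A] [Algebra ℂ A] (n : ℕ) where
  cr : Fin n → A
  an : Fin n → A
  bar : Fin n → A
  contr : Fin n → Fin n → ℂ
  vev : A →ₗ[ℂ] ℂ
  cr_cr : ∀ i j, cr i * cr j = cr j * cr i
  an_an : ∀ i j, an i * an j = an j * an i
  an_cr : ∀ i j, an i * cr j = cr j * an i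
  an_bar : ∀ i j, i < j → an i * bar j = bar j * an i + contr i j • 1
  cr_bar : ∀ i j, j < i → cr i * bar j = bar j * cr i + (-contr i j) • 1
  contr_self : ∀ i, contr i i = 0
  vev_one : vev 1 = 1
  vev_cr : ∀ i x, vev (cr i * x) = 0
  vev_an : ∀ i x, vev (x * an i) = 0

namespace WickSystem

variable {A : Type*} [Ring A] [Algebra ℂ A] {n : ℕ} (S : WickSystem A n)

/-- The normally ordered product of those of the fields `ψ_i` with `i ∈ I` and `bar i` with
`i ∈ J`, for a fixed `i`. -/
def site (I J : Finset (Fin n)) (i : Fin n) : A :=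
  if i ∈ I then
    if i ∈ J then S.cr i * S.bar i + S.bar i * S.an i else S.cr i + S.an i
  else if i ∈ J then S.bar i else 1

theorem mul_site {d : A} {t : ℂ} {j : Fin n} (h1 : d * S.cr j = S.cr j * d)
    (h2 : d * S.an j = S.an j * d) (h3 : d * S.bar j = S.bar j * d + t • 1)
    (I J : Finset (Fin n)) :
    d * S.site I J j = S.site I J j * d +
      if j ∈ J then t • S.site I (J.erase j) j else 0 := by
  unfold site
  have h3' : ∀ x, d * (S.bar j * x) = S.bar j * (d * x) + t • x := by
    intro x
    rw [← mul_assoc, h3, add_mul, smul_mul_assoc, one_mul, mul_assoc]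
  by_cases hI : j ∈ I <;> by_cases hJ : j ∈ J <;>
    simp only [hI, hJ, if_true, if_false, Finset.mem_erase, ne_eq, not_true, false_and]
  · rw [mul_add, add_mul, ← mul_assoc, h1, mul_assoc, h3, h3', h2, mul_add, smul_add,
      mul_smul_comm, mul_one, mul_assoc, mul_assoc]
    abel
  · rw [mul_add, add_mul, h1, h2, add_zero]
  · exact h3
  · rw [mul_one, one_mul, add_zero]

theorem site_erase (I J : Finset (Fin n)) {i j : Fin n} (h : i ≠ j) :
    S.site I (J.erase j) i = S.site I J i := by
  simp [site, h]

/-- The commutator with d is a derivation; its only effect on a site is to remove `bar j` at the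
cost of the scalar t j. -/
theorem mul_list_site {d : A} {t : Fin n → ℂ} (I J : Finset (Fin n)) (l : List (Fin n))
    (hl : l.Nodup) (h1 : ∀ j ∈ l, d * S.cr j = S.cr j * d)
    (h2 : ∀ j ∈ l, d * S.an j = S.an j * d)
    (h3 : ∀ j ∈ l, d * S.bar j = S.bar j * d + t j • 1) :
    d * (l.map (S.site I J)).prod = (l.map (S.site I J)).prod * d +
      ∑ j ∈ J, if j ∈ l then t j • (l.map (S.site I (J.erase j))).prod else 0 := by
  induction l with
  | nil => simp
  | cons k l ih =>
    rw [List.nodup_cons] at hl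
    have ih := ih hl.2 (fun j hj => h1 j (List.mem_cons_of_mem _ hj))
      (fun j hj => h2 j (List.mem_cons_of_mem _ hj)) (fun j hj => h3 j (List.mem_cons_of_mem _ hj))
    rw [List.map_cons, List.prod_cons, ← mul_assoc,
      S.mul_site (h1 k List.mem_cons_self) (h2 k List.mem_cons_self) (h3 k List.mem_cons_self),
      add_mul, mul_assoc, ih, mul_add, ← mul_assoc, add_assoc]
    congr 1
    have hk : (if k ∈ J then t k • S.site I (J.erase k) k else 0) * (l.map (S.site I J)).prod =
        ∑ j ∈ J, if k = j then t j • S.site I (J.erase j) k * (l.map (S.site I J)).prod else 0 := by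
      rw [Finset.sum_ite_eq]
      split_ifs <;> simp
    rw [hk, Finset.mul_sum, ← Finset.sum_add_distrib]
    refine Finset.sum_congr rfl fun j _ => ?_
    by_cases hjk : k = j
    · subst hjk
      have hmap : l.map (S.site I (J.erase k)) = l.map (S.site I J) :=
        List.map_congr_left fun i hi => S.site_erase I J fun h => hl.1 (h ▸ hi)
      simp [hl.1, hmap]
    · have hjk' : ¬ j = k := fun h => hjk h.symm
      simp only [List.mem_cons, hjk, hjk', false_or, if_false, add_zero]
      split_ifs
      · rw [List.map_cons, List.prod_cons, S.site_erase I J hjk, mul_smul_comm]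
      · rw [mul_zero]

/-- The vacuum expectation value of the ordered product of the sites. -/
def corr (I J : Finset (Fin n)) : ℂ := S.vev ((List.finRange n).map (S.site I J)).prod

theorem site_insert (I J : Finset (Fin n)) {i j : Fin n} (h : j ≠ i) :
    S.site (insert i I) J j = S.site I J j := by
  simp [site, h]

/-- Expansion of the permanent along a row. The creation part of ψ_i is moved to the far left and
the annihilation part to the far right, where the vacuum functional kills them. On the way they
contract with the `bar j` for j < i and j > i respectively, and never with `bar i`, since the site
is normally ordered. -/
theorem corr_insert (I J : Finset (Fin n)) (i : Fin n) (hi : i ∉ I) :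
    S.corr (insert i I) J = ∑ j ∈ J, S.contr i j * S.corr I (J.erase j) := by
  obtain ⟨l₁, l₂, hl⟩ := List.append_of_mem (List.mem_finRange i)
  have hnd : (l₁ ++ i :: l₂).Nodup := hl ▸ List.nodup_finRange n
  have hsort : (l₁ ++ i :: l₂).Pairwise (· < ·) := hl ▸ List.pairwise_lt_finRange n
  rw [List.pairwise_append, List.pairwise_cons] at hsort
  obtain ⟨-, ⟨h2, -⟩, h1⟩ := hsort
  have h1 : ∀ j ∈ l₁, j < i := fun j hj => h1 j hj i List.mem_cons_self
  rw [List.nodup_append, List.nodup_cons] at hnd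
  have hs : S.site (insert i I) J i = S.cr i * S.site I J i + S.site I J i * S.an i := by
    simp only [site, Finset.mem_insert_self, if_true, hi, if_false]
    split_ifs <;> simp
  have hm1 : l₁.map (S.site (insert i I) J) = l₁.map (S.site I J) :=
    List.map_congr_left fun j hj => S.site_insert I J (h1 j hj).ne
  have hm2 : l₂.map (S.site (insert i I) J) = l₂.map (S.site I J) :=
    List.map_congr_left fun j hj => S.site_insert I J (h2 j hj).ne'
  have e1 := S.mul_list_site (d := S.cr i) (t := fun j => -S.contr i j) I J l₁ hnd.1
    (fun j _ => S.cr_cr i j) (fun j _ => (S.an_cr j i).symm) fun j hj => S.cr_bar i j (h1 j hj)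
  have e2 := S.mul_list_site (d := S.an i) (t := fun j => S.contr i j) I J l₂ hnd.2.1.2
    (fun j _ => S.an_cr i j) (fun j _ => S.an_an i j) fun j hj => S.an_bar i j (h2 j hj)
  unfold corr
  rw [hl]
  simp only [List.map_append, List.map_cons, List.prod_append, List.prod_cons, hm1, hm2, hs]
  -- Creation operators move leftwards, so the commutation is used in reverse; this cancels the
  -- minus sign in `cr_bar`.
  rw [← sub_eq_iff_eq_add] at e1
  have hv : ∀ x y z, S.vev (x * (y * (z * S.an i))) = 0 := fun x y z => by
    rw [← mul_assoc, ← mul_assoc, S.vev_an]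
  rw [add_mul, mul_add, mul_assoc (S.cr i), ← mul_assoc _ (S.cr i), ← e1, mul_assoc _ (S.an i),
    e2, sub_mul, map_add, map_sub, mul_assoc (S.cr i), S.vev_cr, mul_add, mul_add, map_add, hv,
    zero_sub, zero_add, Finset.sum_mul, Finset.mul_sum,
    Finset.mul_sum, map_sum, map_sum, ← Finset.sum_neg_distrib, ← Finset.sum_add_distrib]
  refine Finset.sum_congr rfl fun j _ => ?_
  rcases lt_trichotomy j i with hj | hj | hj
  · have hj1 : j ∈ l₁ := by
      have := hl ▸ List.mem_finRange j
      rcases List.mem_append.1 this with h | h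
      · exact h
      · rcases List.mem_cons.1 h with h | h
        · exact absurd h hj.ne
        · exact absurd (h2 j h) hj.asymm
    have hj2 : j ∉ l₂ := fun h => (h2 j h).asymm hj
    have hm : l₂.map (S.site I (J.erase j)) = l₂.map (S.site I J) :=
      List.map_congr_left fun k hk => S.site_erase I J fun h => hj2 (h ▸ hk)
    rw [if_pos hj1, if_neg hj2, mul_zero, mul_zero, map_zero, add_zero, hm,
      S.site_erase I J hj.ne', smul_mul_assoc, map_smul, smul_eq_mul]
    ring
  · subst hj
    have hj1 : j ∉ l₁ := fun h => (h1 j h).ne rfl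
    rw [if_neg hj1, if_neg hnd.2.1.1, S.contr_self]
    simp
  · have hj2 : j ∈ l₂ := by
      have := hl ▸ List.mem_finRange j
      rcases List.mem_append.1 this with h | h
      · exact absurd (h1 j h) hj.asymm
      · rcases List.mem_cons.1 h with h | h
        · exact absurd h hj.ne'
        · exact h
    have hj1 : j ∉ l₁ := fun h => (h1 j h).asymm hj
    have hm : l₁.map (S.site I (J.erase j)) = l₁.map (S.site I J) :=
      List.map_congr_left fun k hk => S.site_erase I J fun h => hj1 (h ▸ hk)
    rw [if_pos hj2, if_neg hj1, zero_mul, map_zero, neg_zero, zero_add, hm,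
      S.site_erase I J hj.ne, mul_smul_comm, mul_smul_comm, map_smul, smul_eq_mul]

/-- Iterated row expansion. The rows are enumerated by ρ, so that the induction can pass through
proper subsets; the functions g are the bijections onto J. -/
theorem corr_image {k : ℕ} (ρ : Fin k → Fin n) (hρ : Function.Injective ρ) (J : Finset (Fin n))
    (hJ : J.card = k) :
    S.corr (Finset.univ.image ρ) J = ∑ g : Fin k → Fin n,
      if Function.Injective g ∧ Finset.univ.image g = J then ∏ i, S.contr (ρ i) (g i) else 0 := by
  induction k generalizing J with
  | zero =>
    obtain rfl := Finset.card_eq_zero.1 hJ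
    have h : (Finset.univ : Finset (Fin 0 → Fin n)) = {Fin.elim0} := by
      ext g
      exact iff_of_true (Finset.mem_univ _) (Finset.mem_singleton.2 (Subsingleton.elim _ _))
    rw [h, Finset.sum_singleton, if_pos ⟨fun i => i.elim0, by simp⟩]
    have : (List.finRange n).map (S.site ∅ ∅) = (List.finRange n).map fun _ => 1 :=
      List.map_congr_left fun i _ => by simp [site]
    simp [corr, this, S.vev_one]
  | succ k ih =>
    have hρ' : Function.Injective (fun i : Fin k => ρ i.succ) :=
      fun i j h => Fin.succ_injective _ (hρ h)
    have hins : Finset.univ.image ρ =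
        insert (ρ 0) (Finset.univ.image fun i : Fin k => ρ i.succ) := by
      ext x
      simp [Fin.exists_fin_succ, eq_comm]
    rw [hins, S.corr_insert]
    · rw [← (Fin.consEquiv fun _ => Fin n).sum_comp, Fintype.sum_prod_type]
      rw [← Finset.sum_filter_add_sum_filter_not (s := (Finset.univ : Finset (Fin n)))
        (p := fun j => j ∈ J)]
      rw [Finset.filter_mem_eq_inter, Finset.univ_inter]
      have hzero : ∀ j ∈ Finset.univ.filter (fun j => j ∉ J), ∑ g : Fin k → Fin n,
          (if Function.Injective ((Fin.consEquiv fun _ => Fin n) (j, g)) ∧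
            Finset.univ.image ((Fin.consEquiv fun _ => Fin n) (j, g)) = J then
            ∏ i, S.contr (ρ i) ((Fin.consEquiv fun _ => Fin n) (j, g) i) else 0) = 0 := by
        intro j hj
        refine Finset.sum_eq_zero fun g _ => if_neg ?_
        rintro ⟨-, rfl⟩
        refine (Finset.mem_filter.1 hj).2 (Finset.mem_image.2 ⟨0, Finset.mem_univ _, ?_⟩)
        simp [Fin.consEquiv]
      rw [Finset.sum_eq_zero hzero, add_zero]
      refine Finset.sum_congr rfl fun j hj => ?_
      rw [ih _ hρ' (J.erase j) (by rw [Finset.card_erase_of_mem hj]; omega), Finset.mul_sum]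
      refine Finset.sum_congr rfl fun g _ => ?_
      rw [Fin.prod_univ_succ, mul_ite, mul_zero]
      simp only [Fin.consEquiv, Equiv.coe_fn_mk, Fin.cons_zero, Fin.cons_succ]
      refine if_congr ?_ rfl rfl
      rw [Fin.cons_injective_iff]
      have himg : Finset.univ.image (Fin.cons j g : Fin (k + 1) → Fin n) =
          insert j (Finset.univ.image g) := by
        ext x
        simp [Fin.exists_fin_succ, eq_comm]
      have hmem : j ∈ Set.range g ↔ j ∈ Finset.univ.image g := by simp
      rw [himg, hmem]
      constructor
      · rintro ⟨h1, h2⟩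
        refine ⟨⟨?_, h1⟩, ?_⟩
        · rw [h2]
          simp
        · rw [h2, Finset.insert_erase hj]
      · rintro ⟨⟨h1, h2⟩, rfl⟩
        exact ⟨h2, by rw [Finset.erase_insert h1]⟩
    · rw [Finset.mem_image]
      rintro ⟨i, -, hi⟩
      exact Fin.succ_ne_zero i (hρ hi)

/-- Wick's theorem: the correlation function of `n` normally ordered products is a permanent. -/
theorem corr_univ : S.corr Finset.univ Finset.univ =
    ∑ σ : Equiv.Perm (Fin n), ∏ i, S.contr i (σ i) := by
  have h := S.corr_image id Function.injective_id Finset.univ (by simp)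
  rw [Finset.image_id] at h
  rw [h, ← Finset.sum_filter]
  symm
  refine Finset.sum_bij (fun (σ : Equiv.Perm (Fin n)) _ => (σ : Fin n → Fin n)) ?_ ?_ ?_ ?_
  · intro σ _
    simp [σ.injective, Finset.image_univ_of_surjective σ.surjective]
  · intro σ _ τ _ h
    exact DFunLike.coe_injective h
  · intro g hg
    have hg' := (Finset.mem_filter.1 hg).2.1
    exact ⟨Equiv.ofBijective g (Finite.injective_iff_bijective.1 hg'), Finset.mem_univ _, rfl⟩
  · intro σ _
    rfl

end WickSystem

end

end JordanVOA

namespace JordanVOA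

open TensorProduct

noncomputable section

/-! ### Expansion of products and the number of colourings of cycles -/

theorem list_ofFn_prod_sum {A X : Type*} [Semiring A] [Fintype X] {n : ℕ} (h : Fin n → X → A) :
    (List.ofFn fun i => ∑ x, h i x).prod =
      ∑ g : Fin n → X, (List.ofFn fun i => h i (g i)).prod := by
  induction n with
  | zero => simp
  | succ n ih =>
    rw [List.ofFn_succ, List.prod_cons, ih, Finset.sum_mul_sum,
      ← (Fin.consEquiv fun _ => X).sum_comp, Fintype.sum_prod_type]
    simp [Fin.consEquiv, List.ofFn_succ]

theorem list_ofFn_prod_smul {A : Type*} [Semiring A] [Algebra ℂ A] {n : ℕ} (t : ℂ)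
    (h : Fin n → A) : (List.ofFn fun i => t • h i).prod = t ^ n • (List.ofFn h).prod := by
  induction n with
  | zero => simp
  | succ n ih =>
    rw [List.ofFn_succ, List.ofFn_succ, List.prod_cons, List.prod_cons, ih, smul_mul_smul_comm,
      pow_succ']

/-- An invariant colouring is a colouring of the set of cycles; without fixed points every index
lies on one of the cycle factors. This is the source of the power of r. -/
theorem card_invariant {n N : ℕ} (σ : Equiv.Perm (Fin n)) (hσ : ∀ i, σ i ≠ i) :
    Fintype.card {f : Fin n → Fin N // ∀ i, f i = f (σ i)} = N ^ σ.cycleFactorsFinset.card := by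
  have hmem : ∀ i, σ.cycleOf i ∈ σ.cycleFactorsFinset := fun i =>
    Equiv.Perm.cycleOf_mem_cycleFactorsFinset_iff.2 (Equiv.Perm.mem_support.2 (hσ i))
  let Φ : (σ.cycleFactorsFinset → Fin N) → {f : Fin n → Fin N // ∀ i, f i = f (σ i)} :=
    fun g => ⟨fun i => g ⟨σ.cycleOf i, hmem i⟩, fun i => by
      have h : σ.cycleOf (σ i) = σ.cycleOf i := (Equiv.Perm.cycleOf_self_apply σ i)
      simp only [h]⟩
  have hpt : ∀ τ : σ.cycleFactorsFinset, ∃ i, σ.cycleOf i = τ := by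
    rintro ⟨τ, hτ⟩
    obtain ⟨i, hi⟩ := (Equiv.Perm.mem_cycleFactorsFinset_iff.1 hτ).1.nonempty_support
    exact ⟨i, (Equiv.Perm.cycle_is_cycleOf hi hτ).symm⟩
  have hΦ : Function.Bijective Φ := by
    constructor
    · intro g g' h
      funext τ
      obtain ⟨i, hi⟩ := hpt τ
      have := congrFun (congrArg Subtype.val h) i
      simp only [Φ] at this
      have hτ : (⟨σ.cycleOf i, hmem i⟩ : σ.cycleFactorsFinset) = τ := Subtype.ext hi
      rwa [hτ] at this
    · rintro ⟨f, hf⟩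
      choose c hc using hpt
      refine ⟨fun τ => f (c τ), Subtype.ext (funext fun i => ?_)⟩
      have hpow : ∀ (k : ℕ) (x : Fin n), f ((σ ^ k) x) = f x := by
        intro k
        induction k with
        | zero => intro x; rfl
        | succ k ih =>
          intro x
          rw [pow_succ', Equiv.Perm.mul_apply, ← hf, ih]
      have hs : σ.SameCycle i (c ⟨σ.cycleOf i, hmem i⟩) := by
        rw [Equiv.Perm.sameCycle_iff_cycleOf_eq_of_mem_support
          (Equiv.Perm.mem_support.2 (hσ _)) (Equiv.Perm.mem_support.2 (hσ _)), hc]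
      obtain ⟨k, hk⟩ := hs.exists_nat_pow_eq
      change f (c _) = f i
      rw [← hk, hpow]
  rw [← Fintype.card_of_bijective hΦ, Fintype.card_fun, Fintype.card_fin, Fintype.card_coe]

variable {𝔥 : Type*} [AddCommGroup 𝔥] [Module ℂ 𝔥]
variable (B : LinearMap.BilinForm ℂ 𝔥) (hB : B.IsSymm)

/-! ### Correlation functions on the Fock space -/

/-- The vacuum expectation value of `u(m) v(l)` at level one. -/
def vacPair (u v : 𝔥) (m l : ℤ) : ℂ := if m + l = 0 ∧ l < 0 then (m : ℂ) * B u v else 0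

theorem cocycle_negPart_single (u v : 𝔥) (m l : ℤ) :
    cocycle B (Finsupp.single m u) (negPart (Finsupp.single l v)) = vacPair B u v m l := by
  rw [negPart_single, vacPair]
  split_ifs with h1 h2 h2
  · rw [cocycle_single, if_pos h2.1]
  · rw [cocycle_single, if_neg fun h => h2 ⟨h, h1⟩]
  · exact absurd h2.2 h1
  · exact map_zero _

/-- The vacuum expectation value of the ordered product of `u(m)` at the position `i` and `v(l)` at
the position `j`. -/
def orderedPair {n : ℕ} (i j : Fin n) (u v : 𝔥) (m l : ℤ) : ℂ :=
  if i < j then vacPair B u v m l else if j < i then vacPair B v u l m else 0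

/-- The family equal to `y` where `ε` is true and to `x` elsewhere. -/
def pick {n : ℕ} {X : Type*} (ε : Fin n → Bool) (x y : Fin n → X) (i : Fin n) : X :=
  if ε i then y i else x i

/-- The contribution of `σ` to the correlation function of the `L_{a_i,b_i}(p_i,q_i)`,
at `r = 2`. -/
def modeWeight {n : ℕ} (a b : Fin n → 𝔥) (p q : Fin n → ℤ) (σ : Equiv.Perm (Fin n)) : ℂ :=
  (1 / 2) ^ n * ∑ ε : Fin n → Bool, ∏ i, orderedPair B i (σ i) (pick ε a b i)
    (pick ε b a (σ i)) (pick ε p q i) (pick ε q p (σ i))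

/-- The correlation function of the `L_{a_i,b_i}(p_i,q_i)` as a polynomial in `r / 2`. -/
def corrPoly {n : ℕ} (a b : Fin n → 𝔥) (p q : Fin n → ℤ) : Polynomial ℂ :=
  ∑ σ : derangements (Fin n), Polynomial.C (modeWeight B a b p q σ) *
    Polynomial.X ^ (σ : Equiv.Perm (Fin n)).cycleFactorsFinset.card

section Fock

variable [FiniteDimensional ℂ 𝔥] (N : ℕ)

/-- The fields with flavours `f i`. -/
def fockWick {n : ℕ} (f : Fin n → Fin N) (F G : Fin n → (ℤ →₀ 𝔥)) :
    WickSystem (Module.End ℂ (Fock 𝔥 N)) n where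
  cr i := creation N (f i, false) (F i)
  an i := annihilation B N (f i, false) (F i)
  bar i := field B N (f i, true) (G i)
  contr i j := if i < j then (if f i = f j then cocycle B (F i) (negPart (G j)) else 0)
    else if j < i then (if f i = f j then cocycle B (G j) (negPart (F i)) else 0) else 0
  vev := vev N
  cr_cr i j := creation_comm N _ _ _ _
  an_an i j := annihilation_comm B N _ _ _ _
  an_cr i j := by
    rw [annihilation_creation]
    simp [Flavour.conj]
  an_bar i j hij := by
    rw [annihilation_mul_field, if_pos hij]
    simp only [Flavour.conj, Prod.mk.injEq, Bool.not_false, and_true, eq_comm]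
  cr_bar i j hij := by
    rw [field_mul_creation, if_neg hij.asymm, if_pos hij, neg_smul]
    simp only [Flavour.conj, Prod.mk.injEq, Bool.not_true, and_true]
    abel
  contr_self i := by simp
  vev_one := vev_one N
  vev_cr i x := vev_creation_mul N _ _ x
  vev_an i x := vev_mul_annihilation B N _ _ x

theorem vev_normalProd {n : ℕ} (f : Fin n → Fin N) (F G : Fin n → (ℤ →₀ 𝔥)) :
    vev N (List.ofFn fun i => normalProd B N (f i) (F i) (G i)).prod =
      ∑ σ : Equiv.Perm (Fin n), ∏ i, (fockWick B N f F G).contr i (σ i) := by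
  rw [← (fockWick B N f F G).corr_univ, WickSystem.corr, List.ofFn_eq_map]
  refine congrArg _ (congrArg List.prod (List.map_congr_left fun i _ => ?_))
  rw [WickSystem.site, if_pos (Finset.mem_univ i), if_pos (Finset.mem_univ i)]
  rfl

theorem sum_prod_contr {n : ℕ} (g : Fin n → Fin n → ℂ) (σ : Equiv.Perm (Fin n))
    (hσ : ∀ i, σ i ≠ i) :
    ∑ f : Fin n → Fin N, ∏ i, (if f i = f (σ i) then g i (σ i) else 0) =
      (N : ℂ) ^ σ.cycleFactorsFinset.card * ∏ i, g i (σ i) := by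
  have h : ∀ f : Fin n → Fin N, ∏ i, (if f i = f (σ i) then g i (σ i) else 0) =
      if ∀ i, f i = f (σ i) then ∏ i, g i (σ i) else 0 := by
    intro f
    split_ifs with hf
    · exact Finset.prod_congr rfl fun i _ => if_pos (hf i)
    · push Not at hf
      obtain ⟨i, hi⟩ := hf
      exact Finset.prod_eq_zero (Finset.mem_univ i) (if_neg hi)
  simp only [h]
  rw [← Finset.sum_filter, Finset.sum_const, ← Fintype.card_subtype, card_invariant σ hσ,
    nsmul_eq_mul, Nat.cast_pow]

/-- Each letter is expanded over a colour f i and a bit ε i telling which of its two factors is the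
unconjugated field. Wick's theorem applies to every choice, and the sum over f is carried out with ε
and σ fixed. -/
theorem vev_fockSum {n : ℕ} (a b : Fin n → 𝔥) (p q : Fin n → ℤ) :
    vev N (List.ofFn fun i => fockSum B hB N (quadElt B hB (a i) (b i) (p i) (q i))).prod =
      (corrPoly B a b p q).eval (N : ℂ) := by
  let X : (Fin n → Fin N) → (Fin n → Bool) → Module.End ℂ (Fock 𝔥 N) := fun f ε =>
    (List.ofFn fun i => normalProd B N (f i) (Finsupp.single (pick ε p q i) (pick ε a b i))
      (Finsupp.single (pick ε q p i) (pick ε b a i))).prod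
  have h1 : (List.ofFn fun i => fockSum B hB N (quadElt B hB (a i) (b i) (p i) (q i))).prod =
      (1 / 2 : ℂ) ^ n • ∑ f, ∑ ε, X f ε := by
    simp only [fockSum_quadElt]
    rw [list_ofFn_prod_smul]
    congr 1
    have hs : ∀ i, ∑ α : Fin N, (normalProd B N α (Finsupp.single (p i) (a i))
        (Finsupp.single (q i) (b i)) + normalProd B N α (Finsupp.single (q i) (b i))
        (Finsupp.single (p i) (a i))) = ∑ x : Fin N × Bool, normalProd B N x.1
          (Finsupp.single (if x.2 then q i else p i) (if x.2 then b i else a i))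
          (Finsupp.single (if x.2 then p i else q i) (if x.2 then a i else b i)) := by
      intro i
      rw [Fintype.sum_prod_type]
      refine Finset.sum_congr rfl fun α _ => ?_
      rw [Fintype.sum_bool, add_comm]
      simp
    simp only [hs]
    rw [list_ofFn_prod_sum, ← (Equiv.arrowProdEquivProdArrow (Fin n) (fun _ => Fin N)
      (fun _ => Bool)).symm.sum_comp, Fintype.sum_prod_type]
    rfl
  have h2 : ∀ f ε, vev N (X f ε) = ∑ σ : Equiv.Perm (Fin n), ∏ i,
      (if f i = f (σ i) then orderedPair B i (σ i) (pick ε a b i)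
        (pick ε b a (σ i)) (pick ε p q i) (pick ε q p (σ i)) else 0) := by
    intro f ε
    rw [vev_normalProd]
    refine Finset.sum_congr rfl fun σ _ => Finset.prod_congr rfl fun i _ => ?_
    simp only [fockWick, cocycle_negPart_single, orderedPair]
    split_ifs <;> rfl
  rw [h1, map_smul, map_sum]
  simp only [map_sum, h2]
  rw [Finset.sum_comm]
  have h3 : ∀ ε : Fin n → Bool, ∑ f : Fin n → Fin N, ∑ σ : Equiv.Perm (Fin n), ∏ i,
      (if f i = f (σ i) then orderedPair B i (σ i) (pick ε a b i)
        (pick ε b a (σ i)) (pick ε p q i) (pick ε q p (σ i)) else 0) =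
      ∑ σ : derangements (Fin n), (N : ℂ) ^ (σ : Equiv.Perm (Fin n)).cycleFactorsFinset.card *
        ∏ i, orderedPair B i ((σ : Equiv.Perm (Fin n)) i) (pick ε a b i)
        (pick ε b a ((σ : Equiv.Perm (Fin n)) i)) (pick ε p q i)
        (pick ε q p ((σ : Equiv.Perm (Fin n)) i)) := by
    intro ε
    rw [Finset.sum_comm]
    have h4 : ∀ σ : Equiv.Perm (Fin n), σ ∉ derangements (Fin n) →
        ∑ f : Fin n → Fin N, ∏ i,
        (if f i = f (σ i) then orderedPair B i (σ i) (pick ε a b i)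
        (pick ε b a (σ i)) (pick ε p q i) (pick ε q p (σ i)) else 0) = 0 := by
      intro σ hσ
      simp only [derangements, Set.mem_ofPred_eq, not_forall, not_not] at hσ
      obtain ⟨i, hi⟩ := hσ
      refine Finset.sum_eq_zero fun f _ => Finset.prod_eq_zero (Finset.mem_univ i) ?_
      simp [hi, orderedPair]
    rw [← Finset.sum_subset (Finset.filter_subset (fun σ => σ ∈ derangements (Fin n)) _)
      (fun σ _ hσ => h4 σ fun h => hσ (Finset.mem_filter.2 ⟨Finset.mem_univ _, h⟩))]
    rw [Finset.sum_subtype (p := fun σ => σ ∈ derangements (Fin n)) _ (by simp)]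
    refine Finset.sum_congr rfl fun σ _ => ?_
    exact sum_prod_contr N (fun i j => orderedPair B i j (pick ε a b i)
        (pick ε b a j) (pick ε p q i) (pick ε q p j)) σ σ.2
  simp only [h3]
  rw [corrPoly, Polynomial.eval_finsetSum, Finset.sum_comm, smul_eq_mul, Finset.mul_sum]
  refine Finset.sum_congr rfl fun σ _ => ?_
  rw [Polynomial.eval_mul, Polynomial.eval_C, Polynomial.eval_pow, Polynomial.eval_X, modeWeight,
    ← Finset.mul_sum]
  ring

end Fock

end

end JordanVOA

namespace JordanVOA

open TensorProduct

noncomputable section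

variable {𝔥 : Type*} [AddCommGroup 𝔥] [Module ℂ 𝔥]
variable (B : LinearMap.BilinForm ℂ 𝔥) (hB : B.IsSymm)

/-! ### Interpolation in the level -/

/-- `L_{a_1,b_1}(p_1,q_1) ⋯ L_{a_n,b_n}(p_n,q_n)` in `U(𝔏)`. -/
def quadWord {n : ℕ} (a b : Fin n → 𝔥) (p q : Fin n → ℤ) : UL B hB :=
  (List.ofFn fun i => toUL B hB (quad B hB (a i) (b i) (p i) (q i))).prod

variable [FiniteDimensional ℂ 𝔥]

theorem fockRep_quadWord (N : ℕ) {n : ℕ} (a b : Fin n → 𝔥) (p q : Fin n → ℤ) :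
    fockRep B hB N (quadWord B hB a b p q) =
      (List.ofFn fun i => fockSum B hB N (quadElt B hB (a i) (b i) (p i) (q i))).prod := by
  rw [quadWord, map_list_prod, List.map_ofFn]
  congr 2
  funext i
  exact fockRep_toUL B hB N _

/-- The span of the elements of `U(𝔏)` acting on all Fock spaces by a scalar, monomial in the
number of bosons, times a product of elements `L_{a,b}(m,n)`. -/
def monomialSpan : Submodule ℂ (UL B hB) :=
  Submodule.span ℂ {u | ∃ (t : ℂ) (k n : ℕ) (a b : Fin n → 𝔥) (p q : Fin n → ℤ), ∀ N : ℕ,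
    fockRep B hB N u = (t * (N : ℂ) ^ k) • fockRep B hB N (quadWord B hB a b p q)}

/-- The span is stable under left multiplication by 𝔏: an L_{a,b}(m,n) lengthens the word, and a
multiple of c raises the power of N. As only the actions on Fock spaces are compared, no
faithfulness is required. -/
theorem monomialSpan_eq_top (u : UL B hB) : u ∈ monomialSpan B hB := by
  have hx : ∀ (x : quadSpace B hB) (u : UL B hB), u ∈ monomialSpan B hB →
      toUL B hB x * u ∈ monomialSpan B hB := by
    intro x
    induction x using quadSpace_induction with
    | hquad a b m l =>
      intro u hu
      induction hu using Submodule.span_induction with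
      | mem u hu =>
        obtain ⟨t, k, n, a', b', p, q, h⟩ := hu
        refine Submodule.subset_span ⟨t, k, n + 1, Fin.cons a a', Fin.cons b b', Fin.cons m p,
          Fin.cons l q, fun N => ?_⟩
        rw [map_mul, h, mul_smul_comm, ← map_mul]
        congr 2
        simp [quadWord, List.ofFn_succ]
      | zero => rw [mul_zero]; exact Submodule.zero_mem _
      | add u v _ _ hu hv => rw [mul_add]; exact Submodule.add_mem _ hu hv
      | smul s u _ hu => rw [mul_smul_comm]; exact Submodule.smul_mem _ s hu
    | hcen s x hx =>
      intro u hu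
      induction hu using Submodule.span_induction with
      | mem u hu =>
        obtain ⟨t, k, n, a, b, p, q, h⟩ := hu
        -- The factor 2 and the extra power of N are the scalar 2N by which c acts.
        refine Submodule.subset_span ⟨2 * s * t, k + 1, n, a, b, p, q, fun N => ?_⟩
        rw [map_mul, h, fockRep_toUL, hx, map_smul, fockSum_central, smul_mul_assoc,
          smul_mul_assoc, one_mul, smul_smul, smul_smul]
        congr 1
        ring
      | zero => rw [mul_zero]; exact Submodule.zero_mem _
      | add u v _ _ hu hv => rw [mul_add]; exact Submodule.add_mem _ hu hv
      | smul s u _ hu => rw [mul_smul_comm]; exact Submodule.smul_mem _ s hu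
    | hadd x y hx hy =>
      intro u hu
      rw [map_add, add_mul]
      exact Submodule.add_mem _ (hx u hu) (hy u hu)
    | hsmul s x hx =>
      intro u hu
      rw [map_smul, smul_mul_assoc]
      exact Submodule.smul_mem _ s (hx u hu)
  have key : ∀ u v : UL B hB, v ∈ monomialSpan B hB → u * v ∈ monomialSpan B hB := by
    intro u
    induction u using UL_induction with
    | hal s =>
      intro v hv
      rw [← Algebra.smul_def]
      exact Submodule.smul_mem _ s hv
    | hι x => exact hx x
    | hmul u v hu hv => exact fun w hw => by rw [mul_assoc]; exact hu _ (hv w hw)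
    | hadd u v hu hv =>
      intro w hw
      rw [add_mul]
      exact Submodule.add_mem _ (hu w hw) (hv w hw)
  have := key u 1 (Submodule.subset_span ⟨1, 0, 0, Fin.elim0, Fin.elim0, Fin.elim0, Fin.elim0,
    fun N => by simp [quadWord]⟩)
  rwa [mul_one] at this

theorem exists_vevPoly (u : UL B hB) :
    ∃ P : Polynomial ℂ, ∀ N : ℕ, P.eval (N : ℂ) = vev N (fockRep B hB N u) := by
  have hu := monomialSpan_eq_top B hB u
  induction hu using Submodule.span_induction with
  | mem u hu =>
    obtain ⟨t, k, n, a, b, p, q, h⟩ := hu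
    refine ⟨Polynomial.C t * Polynomial.X ^ k * corrPoly B a b p q, fun N => ?_⟩
    rw [h, map_smul, fockRep_quadWord, vev_fockSum]
    simp
  | zero => exact ⟨0, by simp⟩
  | add u v _ _ hu hv =>
    obtain ⟨P, hP⟩ := hu
    obtain ⟨Q, hQ⟩ := hv
    exact ⟨P + Q, fun N => by simp [hP, hQ]⟩
  | smul s u _ hu =>
    obtain ⟨P, hP⟩ := hu
    exact ⟨s • P, fun N => by simp [hP]⟩

theorem polynomial_ext_nat {P Q : Polynomial ℂ} (h : ∀ N : ℕ, P.eval (N : ℂ) = Q.eval (N : ℂ)) :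
    P = Q := by
  refine Polynomial.eq_of_infinite_eval_eq P Q ?_
  exact (Set.infinite_range_of_injective (Nat.cast_injective (R := ℂ))).mono
    (by rintro _ ⟨N, rfl⟩; exact h N)

/-- The vacuum expectation value as a polynomial in the number of complex bosons. -/
def vevPoly : UL B hB →ₗ[ℂ] Polynomial ℂ where
  toFun u := (exists_vevPoly B hB u).choose
  map_add' u v := polynomial_ext_nat fun N => by
    refine ((exists_vevPoly B hB (u + v)).choose_spec N).trans ?_
    rw [map_add, map_add, Polynomial.eval_add, (exists_vevPoly B hB u).choose_spec N,
      (exists_vevPoly B hB v).choose_spec N]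
  map_smul' s u := polynomial_ext_nat fun N => by
    refine ((exists_vevPoly B hB (s • u)).choose_spec N).trans ?_
    rw [map_smul, map_smul, RingHom.id_apply, Polynomial.eval_smul,
      (exists_vevPoly B hB u).choose_spec N]

theorem eval_vevPoly (u : UL B hB) (N : ℕ) :
    (vevPoly B hB u).eval (N : ℂ) = vev N (fockRep B hB N u) :=
  (exists_vevPoly B hB u).choose_spec N

/-! ### Vacuum conditions and descent to M_r. -/

theorem creationPoly_single_of_nonneg (N : ℕ) (α : Flavour N) (a : 𝔥) {m : ℤ} (hm : 0 ≤ m) :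
    creationPoly N α (Finsupp.single m a) = 0 := by
  simp [creationPoly, not_lt.2 hm]

theorem annihilation_single_of_nonpos (N : ℕ) (α : Flavour N) (a : 𝔥) {m : ℤ} (hm : m ≤ 0) :
    annihilation B N α (Finsupp.single m a) = 0 := by
  have : annihilationDer B N α (Finsupp.single m a) = 0 := by
    refine MvPolynomial.derivation_ext fun s => ?_
    simp only [annihilationDer, MvPolynomial.mkDerivation_X, Derivation.zero_apply]
    split_ifs with h
    · rw [cocycle_single, if_neg (by omega), map_zero]
    · rfl
  refine LinearMap.ext fun v => ?_
  rw [annihilation_apply, this]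
  rfl

/-- On the vacuum only the product of the two creation parts survives, and these vanish for
nonnegative modes. -/
theorem normalProd_one (N : ℕ) (α : Fin N) (a b : 𝔥) {m n : ℤ} (h : 0 ≤ m ∨ 0 ≤ n) :
    normalProd B N α (Finsupp.single m a) (Finsupp.single n b) (1 : Fock 𝔥 N) = 0 := by
  rw [normalProd, LinearMap.add_apply, Module.End.mul_apply, Module.End.mul_apply,
    annihilation_one, map_zero, add_zero, field, LinearMap.add_apply, LinearMap.add_apply,
    annihilation_one, add_zero, creation_apply, creation_apply]
  rcases h with h | h
  · rw [creationPoly_single_of_nonneg N _ a h, zero_mul]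
  · rw [creationPoly_single_of_nonneg N _ b h, zero_mul, mul_zero]

/-- Dually, on the left only two annihilation parts survive, and these vanish for modes at most 0.
The modes -k, k in ω(1) always meet the condition. -/
theorem vev_normalProd_mul (N : ℕ) (α : Fin N) (a b : 𝔥) {m n : ℤ} (h : m ≤ 0 ∨ n ≤ 0)
    (T : Module.End ℂ (Fock 𝔥 N)) :
    vev N (normalProd B N α (Finsupp.single m a) (Finsupp.single n b) * T) = 0 := by
  rw [normalProd, add_mul, map_add, mul_assoc, vev_creation_mul, zero_add]
  rcases h with h | h
  · rw [annihilation_single_of_nonpos B N _ a h, mul_zero, zero_mul, map_zero]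
  · rw [field, LinearMap.add_apply, annihilation_single_of_nonpos B N _ b h, add_zero, mul_assoc,
      vev_creation_mul]

theorem fockRep_posSpace (N : ℕ) (x : quadSpace B hB) (hx : (x : UH B hB) ∈ posSpace B hB) :
    fockRep B hB N (toUL B hB x) (1 : Fock 𝔥 N) = 0 := by
  rw [fockRep_toUL]
  generalize (x : UH B hB) = y at hx
  induction hx using Submodule.span_induction with
  | mem y hy =>
    obtain ⟨a, b, m, n, hmn, rfl⟩ := hy
    rw [fockSum_quadElt, LinearMap.smul_apply, LinearMap.sum_apply, Finset.sum_eq_zero, smul_zero]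
    intro α _
    rw [LinearMap.add_apply, normalProd_one B N α a b hmn, normalProd_one B N α b a hmn.symm,
      add_zero]
  | zero => rw [map_zero]; rfl
  | add y z _ _ hy hz => rw [map_add, LinearMap.add_apply, hy, hz, add_zero]
  | smul t y _ hy => rw [map_smul, LinearMap.smul_apply, hy, smul_zero]

/-- On the Fock spaces right multiplication by 𝔅₊ gives 0 and by c gives the factor 2N, for all N;
as polynomial identities these make c - r vanish at X = r/2. The claim is strengthened to all left
multiples so that it passes through the left ideal. -/
theorem vevPoly_vacIdeal (r : ℂ) (u : UL B hB) (hu : u ∈ vacIdeal B hB r) :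
    (vevPoly B hB u).eval (r / 2) = 0 := by
  suffices h : ∀ v : UL B hB, (vevPoly B hB (v * u)).eval (r / 2) = 0 by
    simpa using h 1
  induction hu using Submodule.span_induction with
  | mem u hu =>
    intro v
    rcases hu with ⟨x, hx, rfl⟩ | ⟨x, hx, rfl⟩
    · have : vevPoly B hB (v * toUL B hB x) = 0 := polynomial_ext_nat fun N => by
        rw [eval_vevPoly, map_mul, vev_apply, Module.End.mul_apply, fockRep_posSpace B hB N x hx]
        simp
      rw [this, Polynomial.eval_zero]
    · have : vevPoly B hB (v * toUL B hB x) =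
          Polynomial.C 2 * Polynomial.X * vevPoly B hB v := polynomial_ext_nat fun N => by
        rw [eval_vevPoly, map_mul, fockRep_toUL, hx, fockSum_central, mul_smul_comm, mul_one,
          map_smul, ← eval_vevPoly]
        simp
      rw [mul_sub, map_sub, this, ← Algebra.commutes, ← Algebra.smul_def, map_smul]
      simp only [Polynomial.eval_sub, Polynomial.eval_mul, Polynomial.eval_C, Polynomial.eval_X,
        Polynomial.eval_smul, smul_eq_mul]
      ring
  | zero => intro v; simp
  | add u w _ _ hu hw => intro v; rw [mul_add, map_add, Polynomial.eval_add, hu, hw, add_zero]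
  | smul t u _ hu => intro v; rw [smul_eq_mul, ← mul_assoc]; exact hu _

theorem exists_functional_Mr (r : ℂ) : ∃ F : Module.Dual ℂ (Mr B hB r),
    ∀ u, F (toMr B hB r u) = (vevPoly B hB u).eval (r / 2) := by
  choose s hs using toMr_surjective B hB r
  have key : ∀ u v, toMr B hB r u = toMr B hB r v →
      (vevPoly B hB u).eval (r / 2) = (vevPoly B hB v).eval (r / 2) := by
    intro u v h
    rw [← sub_eq_zero, ← map_sub, toMr_eq_zero] at h
    have := vevPoly_vacIdeal B hB r _ h
    rwa [map_sub, Polynomial.eval_sub, sub_eq_zero] at this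
  refine ⟨⟨⟨fun v => (vevPoly B hB (s v)).eval (r / 2), fun v w => ?_⟩, fun t v => ?_⟩, fun u => ?_⟩
  · rw [← Polynomial.eval_add, ← map_add]
    refine key _ _ ?_
    rw [hs, map_add, hs, hs]
  · rw [RingHom.id_apply, ← Polynomial.eval_smul, ← map_smul]
    refine key _ _ ?_
    rw [hs, LinearMap.map_smul_of_tower, hs]
  · exact key _ _ (hs _)

/-- The functional on `M_r` given by vacuum expectation values. -/
theorem exists_vacuum_functional (hN : B.Nondegenerate) (r : ℂ) :
    ∃ F : Module.Dual ℂ (Mr B hB r), F (vac B hB r) = 1 ∧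
      (∀ v, F (conformalOp B hB r hN v) = 0) ∧
      ∀ (n : ℕ) (a b : Fin n → 𝔥) (p q : Fin n → ℤ),
        F ((List.ofFn fun i => act B hB r (a i) (b i) (p i) (q i)).prod (vac B hB r)) =
          (corrPoly B a b p q).eval (r / 2) := by
  obtain ⟨F, hF⟩ := exists_functional_Mr B hB r
  have hword : ∀ (n : ℕ) (a b : Fin n → 𝔥) (p q : Fin n → ℤ),
      F ((List.ofFn fun i => act B hB r (a i) (b i) (p i) (q i)).prod (vac B hB r)) =
        (corrPoly B a b p q).eval (r / 2) := by
    intro n a b p q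
    have h : (List.ofFn fun i => act B hB r (a i) (b i) (p i) (q i)).prod (vac B hB r) =
        toMr B hB r (quadWord B hB a b p q) := by
      rw [← smul_vac]
      induction n with
      | zero => simp [quadWord]
      | succ n ih =>
        have h2 : quadWord B hB a b p q = toUL B hB (quad B hB (a 0) (b 0) (p 0) (q 0)) *
            quadWord B hB (fun i => a i.succ) (fun i => b i.succ) (fun i => p i.succ)
              fun i => q i.succ := by
          simp [quadWord, List.ofFn_succ]
        rw [List.ofFn_succ, List.prod_cons, Module.End.mul_apply, ih, h2, mul_smul, act_apply]
        rfl
    rw [h, hF]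
    congr 1
    refine polynomial_ext_nat fun N => ?_
    rw [eval_vevPoly, fockRep_quadWord, vev_fockSum]
  refine ⟨F, ?_, fun v => ?_, hword⟩
  · rw [vac, hF]
    have : vevPoly B hB 1 = 1 := polynomial_ext_nat fun N => by
      rw [eval_vevPoly, map_one, vev_one, Polynomial.eval_one]
    rw [this, Polynomial.eval_one]
  · rw [conformalOp_apply, ← LinearMap.toAddMonoidHom_coe,
      AddMonoidHom.map_finsum _ (support_conformalTerm B hB r hN v), ← finsum_zero (α := ℤ)]
    refine finsum_congr fun k => ?_
    obtain ⟨u, rfl⟩ := toMr_surjective B hB r v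
    rw [← map_smul, LinearMap.toAddMonoidHom_coe, hF, smul_eq_mul]
    have : vevPoly B hB (toUL B hB ⟨conformalTerm B hB hN k, conformalTerm_mem B hB hN k⟩ * u) =
        0 := polynomial_ext_nat fun N => by
      rw [eval_vevPoly, map_mul, fockRep_toUL, Polynomial.eval_zero]
      change vev N (fockSum B hB N (conformalTerm B hB hN k) * _) = 0
      rw [conformalTerm, map_sum, Finset.sum_mul, map_sum]
      refine Finset.sum_eq_zero fun i _ => ?_
      rw [fockSum_quadElt, smul_mul_assoc, map_smul, Finset.sum_mul, map_sum,
        Finset.sum_eq_zero, smul_zero]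
      intro α _
      rw [add_mul, map_add, vev_normalProd_mul B N α _ _ (by omega),
        vev_normalProd_mul B N α _ _ (by omega), add_zero]
    rw [this, Polynomial.eval_zero]

end

end JordanVOA

namespace JordanVOA

open TensorProduct

noncomputable section

variable {𝔥 : Type*} [AddCommGroup 𝔥] [Module ℂ 𝔥]
variable (B : LinearMap.BilinForm ℂ 𝔥)

/-! ### Expansion of the traces -/

theorem cycleEntries_eq {n : ℕ} {τ : Equiv.Perm (Fin n)} (hτ : τ.IsCycle) :
    ∃ x ∈ τ.support, cycleEntries τ = τ.toList x := by
  unfold cycleEntries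
  rw [dif_pos hτ.nonempty_support]
  exact ⟨_, Finset.min'_mem _ _, rfl⟩

theorem mem_cycleEntries {n : ℕ} {τ : Equiv.Perm (Fin n)} (hτ : τ.IsCycle) (k : Fin n) :
    k ∈ cycleEntries τ ↔ k ∈ τ.support := by
  obtain ⟨x, hx, h⟩ := cycleEntries_eq hτ
  rw [h, Equiv.Perm.mem_toList_iff]
  constructor
  · rintro ⟨h1, h2⟩
    exact (h1.mem_support_iff).1 h2
  · intro hk
    exact ⟨hτ.sameCycle (Equiv.Perm.mem_support.1 hx) (Equiv.Perm.mem_support.1 hk), hx⟩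

theorem nodup_cycleEntries {n : ℕ} {τ : Equiv.Perm (Fin n)} (hτ : τ.IsCycle) :
    (cycleEntries τ).Nodup := by
  obtain ⟨x, hx, h⟩ := cycleEntries_eq hτ
  rw [h]
  exact Equiv.Perm.nodup_toList _ _

theorem tensorListProd_cons (x : 𝔥 ⊗[ℂ] 𝔥) {l : List (𝔥 ⊗[ℂ] 𝔥)} (hl : l ≠ []) :
    tensorListProd B (x :: l) = tensorMul B x (tensorListProd B l) := by
  cases l with
  | nil => exact absurd rfl hl
  | cons y l => rfl

theorem map_update_of_notMem {ι X : Type*} [DecidableEq ι] (T : ι → X) (k : ι) (x : X)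
    {l : List ι} (hk : k ∉ l) : l.map (Function.update T k x) = l.map T :=
  List.map_congr_left fun i hi =>
    Function.update_of_ne (fun h : i = k => hk (h ▸ hi)) x T

/-- Linearity in the entry k holds because k occurs exactly once in the list. -/
theorem tensorListProd_update {ι : Type*} [DecidableEq ι] (T : ι → 𝔥 ⊗[ℂ] 𝔥) (k : ι)
    (l : List ι) (hl : l.Nodup) (hk : k ∈ l) :
    (∀ x y, tensorListProd B (l.map (Function.update T k (x + y))) =
      tensorListProd B (l.map (Function.update T k x)) +
        tensorListProd B (l.map (Function.update T k y))) ∧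
    ∀ (t : ℂ) (x), tensorListProd B (l.map (Function.update T k (t • x))) =
      t • tensorListProd B (l.map (Function.update T k x)) := by
  induction l with
  | nil => simp at hk
  | cons j l ih =>
    rw [List.nodup_cons] at hl
    by_cases hne : l = []
    · subst hne
      obtain rfl : k = j := by simpa using hk
      simp [tensorListProd]
    · have hcons : ∀ x, tensorListProd B ((j :: l).map (Function.update T k x)) =
          tensorMul B (Function.update T k x j)
            (tensorListProd B (l.map (Function.update T k x))) := fun x => by
        rw [List.map_cons, tensorListProd_cons B _ (by simpa using hne)]
      simp only [hcons]
      rcases List.mem_cons.1 hk with rfl | hk'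
      · simp only [map_update_of_notMem T k _ hl.1, Function.update_self]
        exact ⟨fun x y => by rw [map_add, LinearMap.add_apply],
          fun t x => by rw [map_smul, LinearMap.smul_apply]⟩
      · have hjk : j ≠ k := fun h => hl.1 (h ▸ hk')
        obtain ⟨h1, h2⟩ := ih hl.2 hk'
        simp only [Function.update_of_ne hjk, h1, h2, map_add, map_smul, implies_true, and_self]

/-- Cycles are disjoint, so only the cycle through k sees a change at k; this gives multilinearity
of the product of traces. -/
theorem prod_trace_erase_update {n : ℕ} (σ : Equiv.Perm (Fin n)) (T : Fin n → 𝔥 ⊗[ℂ] 𝔥)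
    (k : Fin n) (x : 𝔥 ⊗[ℂ] 𝔥) :
    ∏ τ ∈ σ.cycleFactorsFinset.erase (σ.cycleOf k),
      tensorTrace B (tensorListProd B ((cycleEntries τ).map (Function.update T k x))) =
    ∏ τ ∈ σ.cycleFactorsFinset.erase (σ.cycleOf k),
      tensorTrace B (tensorListProd B ((cycleEntries τ).map T)) := by
  refine Finset.prod_congr rfl fun τ hτ => ?_
  rw [Finset.mem_erase] at hτ
  rw [map_update_of_notMem]
  rw [mem_cycleEntries (Equiv.Perm.mem_cycleFactorsFinset_iff.1 hτ.2).1]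
  exact fun h => hτ.1 (Equiv.Perm.cycle_is_cycleOf h hτ.2)

/-- The product of the traces along the cycles of a derangement, as a multilinear map. -/
def cycleTraces {n : ℕ} (σ : Equiv.Perm (Fin n)) (hσ : ∀ i, σ i ≠ i) :
    MultilinearMap ℂ (fun _ : Fin n => 𝔥 ⊗[ℂ] 𝔥) ℂ :=
  MultilinearMap.mk' (fun T => ∏ τ ∈ σ.cycleFactorsFinset,
      tensorTrace B (tensorListProd B ((cycleEntries τ).map T)))
    (by
      intro T k x y
      have hmem : σ.cycleOf k ∈ σ.cycleFactorsFinset :=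
        Equiv.Perm.cycleOf_mem_cycleFactorsFinset_iff.2 (Equiv.Perm.mem_support.2 (hσ k))
      have hc := (Equiv.Perm.mem_cycleFactorsFinset_iff.1 hmem).1
      simp only [← Finset.mul_prod_erase _ _ hmem, prod_trace_erase_update]
      rw [(tensorListProd_update B T k _ (nodup_cycleEntries hc) ((mem_cycleEntries hc k).2
        (Equiv.Perm.mem_support_cycleOf_iff.2 ⟨Equiv.Perm.SameCycle.refl _ _,
          Equiv.Perm.mem_support.2 (hσ k)⟩))).1, map_add, add_mul])
    (by
      intro T k t x
      have hmem : σ.cycleOf k ∈ σ.cycleFactorsFinset :=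
        Equiv.Perm.cycleOf_mem_cycleFactorsFinset_iff.2 (Equiv.Perm.mem_support.2 (hσ k))
      have hc := (Equiv.Perm.mem_cycleFactorsFinset_iff.1 hmem).1
      simp only [← Finset.mul_prod_erase _ _ hmem, prod_trace_erase_update]
      rw [(tensorListProd_update B T k _ (nodup_cycleEntries hc) ((mem_cycleEntries hc k).2
        (Equiv.Perm.mem_support_cycleOf_iff.2 ⟨Equiv.Perm.SameCycle.refl _ _,
          Equiv.Perm.mem_support.2 (hσ k)⟩))).2, map_smul, smul_eq_mul, smul_eq_mul, mul_assoc])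

/-- The inner factors contract in consecutive pairs, leaving the first X and the last Y. -/
theorem tensorListProd_iterate {ι : Type*} (f : ι → ι) (X Y : ι → 𝔥) (t : ℕ) (x : ι) :
    tensorListProd B ((List.iterate f x (t + 1)).map fun k => X k ⊗ₜ[ℂ] Y k) =
      ((List.iterate f x t).map fun k => B (Y k) (X (f k))).prod • (X x ⊗ₜ Y (f^[t] x)) := by
  induction t generalizing x with
  | zero => simp [tensorListProd]
  | succ t ih =>
    rw [List.iterate, List.map_cons, tensorListProd_cons B _ (by simp), ih (f x), List.iterate,
      List.map_cons, List.prod_cons, map_smul, tensorMul_tmul, smul_smul, mul_comm,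
      Function.iterate_succ_apply]

theorem list_iterate_succ_prod {ι : Type*} (f : ι → ι) (g : ι → ℂ) (t : ℕ) (x : ι) :
    ((List.iterate f x (t + 1)).map g).prod = ((List.iterate f x t).map g).prod * g (f^[t] x) := by
  induction t generalizing x with
  | zero => simp
  | succ t ih =>
    rw [List.iterate, List.map_cons, List.prod_cons, ih, List.iterate, List.map_cons,
      List.prod_cons, mul_assoc, Function.iterate_succ_apply]

theorem tensorTrace_cycle (hB : B.IsSymm) {n : ℕ} {τ : Equiv.Perm (Fin n)} (hτ : τ.IsCycle)
    (X Y : Fin n → 𝔥) :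
    tensorTrace B (tensorListProd B ((cycleEntries τ).map fun k => X k ⊗ₜ[ℂ] Y k)) =
      ∏ k ∈ τ.support, B (Y k) (X (τ k)) := by
  have hsup : τ.support = (cycleEntries τ).toFinset := by
    ext k
    rw [List.mem_toFinset, mem_cycleEntries hτ]
  rw [hsup, List.prod_toFinset _ (nodup_cycleEntries hτ)]
  obtain ⟨x, hx, h⟩ := cycleEntries_eq hτ
  have hcyc : τ.cycleOf x = τ := hτ.cycleOf_eq (Equiv.Perm.mem_support.1 hx)
  obtain ⟨t, ht⟩ : ∃ t, τ.support.card = t + 1 :=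
    Nat.exists_eq_add_one.2 (Finset.card_pos.2 ⟨x, hx⟩)
  rw [h, Equiv.Perm.toList, hcyc, ht, tensorListProd_iterate, map_smul, list_iterate_succ_prod,
    smul_eq_mul]
  congr 1
  -- The trace supplies the missing pairing: t + 1 is the order of the cycle, so the last entry is
  -- followed by x.
  rw [tensorTrace, TensorProduct.lift.tmul, hB.eq, ← Function.iterate_succ_apply' τ t x,
    Nat.succ_eq_add_one, ← ht, ← hτ.orderOf, Equiv.Perm.iterate_eq_pow τ (orderOf τ), pow_orderOf_eq_one,
    Equiv.Perm.one_apply]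

theorem cycleTraces_tmul (hB : B.IsSymm) {n : ℕ} (σ : Equiv.Perm (Fin n)) (hσ : ∀ i, σ i ≠ i)
    (X Y : Fin n → 𝔥) :
    cycleTraces B σ hσ (fun k => X k ⊗ₜ[ℂ] Y k) = ∏ k, B (Y k) (X (σ k)) := by
  have hmem : ∀ k, σ.cycleOf k ∈ σ.cycleFactorsFinset := fun k =>
    Equiv.Perm.cycleOf_mem_cycleFactorsFinset_iff.2 (Equiv.Perm.mem_support.2 (hσ k))
  have hfib := Finset.prod_fiberwise_of_maps_to (s := Finset.univ) (g := fun k => σ.cycleOf k)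
    (t := σ.cycleFactorsFinset) (fun k _ => hmem k) (fun k => B (Y k) (X (σ k)))
  rw [← hfib]
  change ∏ τ ∈ σ.cycleFactorsFinset,
    tensorTrace B (tensorListProd B ((cycleEntries τ).map fun k => X k ⊗ₜ[ℂ] Y k)) = _
  refine Finset.prod_congr rfl fun τ hτ => ?_
  rw [tensorTrace_cycle B hB (Equiv.Perm.mem_cycleFactorsFinset_iff.1 hτ).1]
  have hset : Finset.univ.filter (fun k => σ.cycleOf k = τ) = τ.support := by
    ext k
    rw [Finset.mem_filter]
    constructor
    · rintro ⟨-, rfl⟩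
      exact Equiv.Perm.mem_support_cycleOf_iff.2 ⟨Equiv.Perm.SameCycle.refl _ _,
          Equiv.Perm.mem_support.2 (hσ k)⟩
    · exact fun h => ⟨Finset.mem_univ _, (Equiv.Perm.cycle_is_cycleOf h hτ).symm⟩
  rw [hset]
  exact Finset.prod_congr rfl fun k hk => by
    rw [(Equiv.Perm.mem_cycleFactorsFinset_iff.1 hτ).2 k hk]

theorem gammaT_eq (hB : B.IsSymm) {n : ℕ} (a b : Fin n → 𝔥) (σ : Equiv.Perm (Fin n))
    (hσ : ∀ i, σ i ≠ i) :
    gammaT B a b σ = (1 / 2) ^ σ.cycleFactorsFinset.card * ((1 / 2) ^ n *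
      ∑ ε : Fin n → Bool, ∏ i, B (pick ε a b i) (pick ε b a (σ i))) := by
  have h : ∏ τ ∈ σ.cycleFactorsFinset, tensorTrace B
        (tensorListProd B ((cycleEntries τ).map fun k => symTensor (a k) (b k))) =
      ∑ ε : Fin n → Bool, ∏ i, B (pick ε a b i) (pick ε b a (σ i)) := by
    change cycleTraces B σ hσ (fun k => symTensor (a k) (b k)) = _
    have hs : (fun k => symTensor (a k) (b k)) = fun k => ∑ e : Bool,
        (if e then a k else b k) ⊗ₜ[ℂ] (if e then b k else a k) := by
      funext k
      simp [symTensor]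
    rw [hs, MultilinearMap.map_sum]
    refine Finset.sum_congr rfl fun ε _ => ?_
    exact cycleTraces_tmul B hB σ hσ _ _
  rw [gammaT, h, ← mul_assoc, zpow_sub₀ two_ne_zero, zpow_neg, zpow_natCast, zpow_natCast]
  congr 1
  simp [div_eq_mul_inv]

end

end JordanVOA

namespace JordanVOA

open TensorProduct

noncomputable section

variable {𝔥 : Type*} [AddCommGroup 𝔥] [Module ℂ 𝔥]
variable (B : LinearMap.BilinForm ℂ 𝔥)

/-! ### Summation over the modes -/

/-- Only the mode pairs (k+1, -(k+1)) with k ≥ 0 contribute, and ∑ (k+1) w^k z^(-k-2) = (z - w)⁻².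
-/
theorem hasSum_vacPair (u v : 𝔥) {z w : ℂ} (h : ‖w‖ < ‖z‖) :
    HasSum (fun x : ℤ × ℤ => vacPair B u v x.1 x.2 * (z ^ (-x.1 - 1) * w ^ (-x.2 - 1)))
      (B u v * (1 / (z - w) ^ 2)) := by
  have hz : z ≠ 0 := norm_pos_iff.1 ((norm_nonneg w).trans_lt h)
  have hx : ‖w / z‖ < 1 := by
    rw [norm_div, div_lt_one (norm_pos_iff.2 hz)]
    exact h
  have hinj : Function.Injective fun k : ℕ => ((k + 1 : ℤ), (-(k + 1) : ℤ)) := by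
    intro k l hkl
    have := congrArg Prod.fst hkl
    simp only at this
    omega
  rw [← hinj.hasSum_iff]
  · have hs := (hasSum_choose_mul_geometric_of_norm_lt_one 1 hx).mul_left (B u v * (z ^ 2)⁻¹)
    convert! hs using 1
    · funext k
      simp only [Function.comp_apply, vacPair]
      rw [if_pos (by omega), Nat.choose_one_right, div_pow]
      have h1 : z ^ (-((k : ℤ) + 1) - 1) = (z ^ (k + 2))⁻¹ := by
        rw [← zpow_natCast, ← zpow_neg, show -((k : ℤ) + 1) - 1 = -((k + 2 : ℕ) : ℤ) by
          push_cast
          ring]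
      have h2 : w ^ (-(-((k : ℤ) + 1)) - 1) = w ^ k := by
        rw [← zpow_natCast, neg_neg, add_sub_cancel_right]
      rw [h1, h2, pow_add]
      push_cast
      field_simp
    · have hzw : z - w ≠ 0 := by
        intro h0
        rw [sub_eq_zero] at h0
        rw [h0] at h
        exact lt_irrefl _ h
      have : 1 - w / z = (z - w) / z := by field_simp
      rw [this, div_pow]
      field_simp
      ring
  · rintro ⟨m, l⟩ hml
    simp only [vacPair]
    rw [if_neg, zero_mul]
    rintro ⟨h1, h2⟩
    refine hml ⟨(m - 1).toNat, ?_⟩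
    simp only [Prod.mk.injEq]
    omega

theorem hasSum_orderedPair (hB : B.IsSymm) {n : ℕ} {z : Fin n → ℂ}
    (hz : StrictAnti fun i => ‖z i‖) {i j : Fin n} (hij : i ≠ j) (u v : 𝔥) :
    HasSum (fun x : ℤ × ℤ => orderedPair B i j u v x.1 x.2 *
      (z i ^ (-x.1 - 1) * z j ^ (-x.2 - 1))) (B u v * (1 / (z i - z j) ^ 2)) := by
  unfold orderedPair
  rcases lt_or_gt_of_ne hij with h | h
  · simp only [if_pos h]
    exact hasSum_vacPair B u v (hz h)
  · simp only [if_neg h.asymm, if_pos h]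
    have := (Equiv.prodComm ℤ ℤ).hasSum_iff.2 (hasSum_vacPair B v u (hz h))
    convert this using 1
    · funext x
      simp only [Function.comp_apply, Equiv.prodComm_apply, Prod.fst_swap, Prod.snd_swap]
      ring
    · rw [hB.eq]
      congr 2
      ring

/-- Summability in ℂ is absolute, so finitely many series in independent indices may be multiplied.
-/
theorem hasSum_pi_prod {ι : Type*} {n : ℕ} (h : Fin n → ι → ℂ) (s : Fin n → ℂ)
    (hs : ∀ i, HasSum (h i) (s i)) :
    HasSum (fun g : Fin n → ι => ∏ i, h i (g i)) (∏ i, s i) := by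
  induction n with
  | zero =>
    simp only [Finset.univ_eq_empty, Finset.prod_empty]
    exact hasSum_unique _
  | succ n ih =>
    have ih := ih (fun i => h i.succ) (fun i => s i.succ) fun i => hs i.succ
    rw [← (Fin.consEquiv fun _ => ι).hasSum_iff, Fin.prod_univ_succ]
    set G : (Fin n → ι) → ℂ := fun g => ∏ i : Fin n, h i.succ (g i) with hG
    have n1 : Summable fun x => ‖h 0 x‖ := summable_norm_iff.2 (hs 0).summable
    have n2 : Summable fun x => ‖G x‖ := summable_norm_iff.2 ih.summable
    have hsum := summable_mul_of_summable_norm n1 n2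
    have hm : HasSum (fun x : ι × (Fin n → ι) => h 0 x.1 * G x.2)
        (s 0 * ∏ i : Fin n, s i.succ) := (hs 0).mul ih hsum
    convert! hm using 1
    funext x
    simp [hG, Fin.consEquiv, Fin.prod_univ_succ]

/-- `(P, Q) ↦ (i ↦ (P i, Q (σ i)))`. -/
def pairEquiv {n : ℕ} (σ : Equiv.Perm (Fin n)) :
    (Fin n → ℤ) × (Fin n → ℤ) ≃ (Fin n → ℤ × ℤ) where
  toFun x i := (x.1 i, x.2 (σ i))
  invFun g := (fun i => (g i).1, fun i => (g (σ.symm i)).2)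
  left_inv x := by simp
  right_inv g := by simp

/-- The contraction at i involves the field mode at i and the conjugate mode at σ(i); attaching both
to i makes the n double series independent. -/
theorem hasSum_prod_orderedPair (hB : B.IsSymm) {n : ℕ} {z : Fin n → ℂ}
    (hz : StrictAnti fun i => ‖z i‖) (σ : Equiv.Perm (Fin n)) (hσ : ∀ i, σ i ≠ i)
    (u v : Fin n → 𝔥) :
    HasSum (fun x : (Fin n → ℤ) × (Fin n → ℤ) =>
      (∏ i, orderedPair B i (σ i) (u i) (v (σ i)) (x.1 i) (x.2 (σ i))) *
        ∏ i, (z i ^ (-x.1 i - 1) * z i ^ (-x.2 i - 1)))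
      ((∏ i, B (u i) (v (σ i))) * gammaZ z σ) := by
  have h := (pairEquiv σ).hasSum_iff.2 (hasSum_pi_prod _ _ fun i =>
    hasSum_orderedPair B hB hz (hσ i).symm (u i) (v (σ i)))
  convert h using 1
  · funext x
    simp only [Function.comp_apply, pairEquiv, Equiv.coe_fn_mk, Finset.prod_mul_distrib]
    rw [Equiv.prod_comp σ fun i => z i ^ (-x.2 i - 1)]
  · rw [gammaZ, Finset.prod_mul_distrib]

/-- The modes `(p, q)` of the two factors in the order prescribed by `ε`, in terms of the total
mode and the mode of the second factor. -/
def modeEquiv {n : ℕ} (ε : Fin n → Bool) :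
    (Fin n → ℤ) × (Fin n → ℤ) ≃ (Fin n → ℤ) × (Fin n → ℤ) where
  toFun x := (pick ε (fun i => -x.2 i + x.1 i - 1) x.2, pick ε x.2 fun i => -x.2 i + x.1 i - 1)
  invFun y := (fun i => y.1 i + y.2 i + 1, pick ε y.2 y.1)
  left_inv x := by
    refine Prod.ext (funext fun i => ?_) (funext fun i => ?_) <;> simp only [pick] <;> split_ifs <;>
      ring
  right_inv x := by
    refine Prod.ext (funext fun i => ?_) (funext fun i => ?_) <;> simp only [pick] <;> split_ifs <;>
      ring

/-- One of the points may be 0, where integer powers are not additive; for negative modes all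
exponents are natural numbers and the identity survives. -/
theorem zpow_mode {z : ℂ} {P Q m : ℤ} (hm : m = P + Q + 1) (h : z ≠ 0 ∨ (P < 0 ∧ Q < 0)) :
    z ^ (-m - 1) = z ^ (-P - 1) * z ^ (-Q - 1) := by
  rcases h with h | ⟨hP, hQ⟩
  · rw [← zpow_add₀ h]
    congr 1
    omega
  · obtain ⟨p, rfl⟩ := Int.eq_negSucc_of_lt_zero hP
    obtain ⟨q, rfl⟩ := Int.eq_negSucc_of_lt_zero hQ
    have h1 : -Int.negSucc p - 1 = p := by simp [Int.negSucc_eq]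
    have h2 : -Int.negSucc q - 1 = q := by simp [Int.negSucc_eq]
    have h3 : -m - 1 = ((p + q : ℕ) : ℤ) := by
      rw [hm]
      push_cast [Int.negSucc_eq]
      ring
    rw [h1, h2, h3, zpow_natCast, zpow_natCast, zpow_natCast, pow_add]

theorem neg_of_orderedPair_ne_zero {n : ℕ} {i j : Fin n} {u v : 𝔥} {m l : ℤ}
    (h : orderedPair B i j u v m l ≠ 0) : (i < j → l < 0) ∧ (j < i → m < 0) := by
  unfold orderedPair vacPair at h
  constructor
  · intro hij
    rw [if_pos hij] at h
    by_contra hl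
    exact h (if_neg fun h' => hl h'.2)
  · intro hij
    rw [if_neg hij.asymm, if_pos hij] at h
    by_contra hl
    exact h (if_neg fun h' => hl h'.2)

theorem hasSum_modes (hB : B.IsSymm) {n : ℕ} {z : Fin n → ℂ}
    (hz : StrictAnti fun i => ‖z i‖) (σ : Equiv.Perm (Fin n)) (hσ : ∀ i, σ i ≠ i)
    (a b : Fin n → 𝔥) (ε : Fin n → Bool) :
    HasSum (fun x : (Fin n → ℤ) × (Fin n → ℤ) =>
      (∏ i, orderedPair B i (σ i) (pick ε a b i) (pick ε b a (σ i))
        (pick ε (fun i => -x.2 i + x.1 i - 1) x.2 i)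
        (pick ε x.2 (fun i => -x.2 i + x.1 i - 1) (σ i))) * ∏ i, z i ^ (-x.1 i - 1))
      ((∏ i, B (pick ε a b i) (pick ε b a (σ i))) * gammaZ z σ) := by
  have h := (modeEquiv ε).hasSum_iff.2 (hasSum_prod_orderedPair B hB hz σ hσ (pick ε a b)
    (pick ε b a))
  convert h using 1
  funext x
  simp only [Function.comp_apply, modeEquiv, Equiv.coe_fn_mk]
  by_cases h0 : ∏ i, orderedPair B i (σ i) (pick ε a b i) (pick ε b a (σ i))
        (pick ε (fun i => -x.2 i + x.1 i - 1) x.2 i)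
        (pick ε x.2 (fun i => -x.2 i + x.1 i - 1) (σ i)) = 0
  · rw [h0, zero_mul, zero_mul]
  · congr 1
    replace h0 := Finset.prod_ne_zero_iff.1 h0
    refine Finset.prod_congr rfl fun i _ => zpow_mode ?_ ?_
    · simp only [pick]
      split_ifs <;> ring
    -- If z i = 0 then i is the last position, so both σ(i) and σ⁻¹(i) precede it. In a nonzero
    -- contraction the later operator has negative mode, so both modes at i are negative.
    · by_cases hzi : z i = 0
      · right
        have hlt : ∀ j, j ≠ i → j < i := by
          intro j hj
          refine lt_of_le_of_ne (not_lt.1 fun hij => ?_) hj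
          have := hz hij
          simp only [hzi, norm_zero] at this
          exact absurd this (not_lt.2 (norm_nonneg _))
        constructor
        · exact (neg_of_orderedPair_ne_zero B (h0 i (Finset.mem_univ i))).2 (hlt _ (hσ i))
        · have h1 := (neg_of_orderedPair_ne_zero B (h0 (σ.symm i) (Finset.mem_univ _))).1
          rw [Equiv.apply_symm_apply] at h1
          refine h1 (hlt _ fun h2 => hσ (σ.symm i) ?_)
          rw [Equiv.apply_symm_apply]
          exact h2.symm
      · exact Or.inl hzi

theorem hasSum_corrPoly (hB : B.IsSymm) {n : ℕ} {z : Fin n → ℂ}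
    (hz : StrictAnti fun i => ‖z i‖) (a b : Fin n → 𝔥) (s : ℂ) :
    HasSum (fun x : (Fin n → ℤ) × (Fin n → ℤ) =>
      (corrPoly B a b (fun i => -x.2 i + x.1 i - 1) x.2).eval s * ∏ i, z i ^ (-x.1 i - 1))
      (∑ σ : derangements (Fin n), (1 / 2) ^ n * (∑ ε : Fin n → Bool,
        (∏ i, B (pick ε a b i) (pick ε b a ((σ : Equiv.Perm (Fin n)) i))) * gammaZ z σ) *
          s ^ (σ : Equiv.Perm (Fin n)).cycleFactorsFinset.card) := by
  have h := hasSum_sum (s := (Finset.univ : Finset (derangements (Fin n)))) fun σ _ =>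
    ((hasSum_sum (s := (Finset.univ : Finset (Fin n → Bool))) fun ε _ =>
      hasSum_modes B hB hz σ σ.2 a b ε).mul_left ((1 / 2 : ℂ) ^ n)).mul_right
        (s ^ (σ : Equiv.Perm (Fin n)).cycleFactorsFinset.card)
  convert! h using 1
  funext x
  rw [corrPoly, Polynomial.eval_finsetSum, Finset.sum_mul]
  refine Finset.sum_congr rfl fun σ _ => ?_
  rw [Polynomial.eval_mul, Polynomial.eval_C, Polynomial.eval_pow, Polynomial.eval_X, modeWeight,
    ← Finset.sum_mul]
  ring

/-- The inner sum has finite support by induction, and each of its finitely many vectors meets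
finitely many terms of the outer mode; so the iterated sums merge into one finite sum. -/
theorem modeWord_eq_finsum (hB : B.IsSymm) (r : ℂ) {n : ℕ} (a b : Fin n → 𝔥) (m : Fin n → ℤ) :
    (Function.support fun k : Fin n → ℤ => (List.ofFn fun i =>
      act B hB r (a i) (b i) (-k i + m i - 1) (k i)).prod (vac B hB r)).Finite ∧
    modeWord B hB r a b m = ∑ᶠ k : Fin n → ℤ, (List.ofFn fun i =>
      act B hB r (a i) (b i) (-k i + m i - 1) (k i)).prod (vac B hB r) := by
  induction n with
  | zero =>
    refine ⟨Set.toFinite _, ?_⟩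
    rw [finsum_unique]
    simp [modeWord]
  | succ n ih =>
    obtain ⟨hfin, heq⟩ := ih (fun i => a i.succ) (fun i => b i.succ) fun i => m i.succ
    set w : (Fin n → ℤ) → Mr B hB r := fun k => (List.ofFn fun i =>
      act B hB r (a i.succ) (b i.succ) (-k i + m i.succ - 1) (k i)).prod (vac B hB r) with hw
    let e := Fin.consEquiv fun _ : Fin (n + 1) => ℤ
    let f : ℤ × (Fin n → ℤ) → Mr B hB r := fun x =>
      act B hB r (a 0) (b 0) (-x.1 + m 0 - 1) x.1 (w x.2)
    have hf : ∀ x, (List.ofFn fun i => act B hB r (a i) (b i) (-e x i + m i - 1)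
        (e x i)).prod (vac B hB r) = f x := by
      intro x
      simp [f, hw, e, Fin.consEquiv, List.ofFn_succ]
    have hffin : (Function.support f).Finite := by
      refine ((hfin.biUnion fun k _ => (locFin (w k) (a 0) (b 0) (m 0)).prod
        (Set.finite_singleton k))).subset ?_
      rintro ⟨k0, k⟩ hk
      have hwk : w k ≠ 0 := fun h => hk (by simp [f, h])
      exact Set.mem_biUnion hwk ⟨hk, rfl⟩
    constructor
    · refine (hffin.image e).subset fun k hk => ?_
      obtain ⟨x, rfl⟩ := e.surjective k
      refine ⟨x, ?_, rfl⟩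
      rw [Function.mem_support, hf] at hk
      exact hk
    · have h : modeWord B hB r a b m = mode B hB r (a 0) (b 0) (m 0)
          (modeWord B hB r (fun i => a i.succ) (fun i => b i.succ) fun i => m i.succ) := by
        simp [modeWord, List.ofFn_succ]
      rw [h, heq, ← finsum_comp_equiv e]
      simp only [hf]
      rw [finsum_curry _ hffin]
      change ∑ᶠ k : ℤ, _ = _
      refine finsum_congr fun k => ?_
      rw [← LinearMap.toAddMonoidHom_coe]
      exact AddMonoidHom.map_finsum _ hfin

theorem hasSum_functional_modeWord (hB : B.IsSymm) (r : ℂ) (F : Module.Dual ℂ (Mr B hB r))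
    {n : ℕ} (a b : Fin n → 𝔥) (m : Fin n → ℤ) :
    HasSum (fun k : Fin n → ℤ => F ((List.ofFn fun i =>
      act B hB r (a i) (b i) (-k i + m i - 1) (k i)).prod (vac B hB r)))
      (F (modeWord B hB r a b m)) := by
  obtain ⟨hfin, heq⟩ := modeWord_eq_finsum B hB r a b m
  rw [heq, finsum_eq_sum_of_support_subset _ (s := hfin.toFinset) (by simp), map_sum]
  refine hasSum_sum_of_ne_finset_zero fun k hk => ?_
  rw [Set.Finite.mem_toFinset, Function.mem_support, not_not] at hk
  rw [hk, map_zero]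

end

end JordanVOA

theorem theorem1 {𝔥 : Type*} [AddCommGroup 𝔥] [Module ℂ 𝔥] [FiniteDimensional ℂ 𝔥]
    (B : LinearMap.BilinForm ℂ 𝔥) (hB : B.IsSymm) (hN : B.Nondegenerate) (r : ℂ) :
    (∃! φ : Module.Dual ℂ (JordanVOA.V B hB r), JordanVOA.IsVacuumFunctional B hB r hN φ) ∧
    ∀ φ : Module.Dual ℂ (JordanVOA.V B hB r), JordanVOA.IsVacuumFunctional B hB r hN φ →
      ∀ (n : ℕ) (a b : Fin n → 𝔥) (z : Fin n → ℂ), StrictAnti (fun i => ‖z i‖) →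
        HasSum
          (fun m : Fin n → ℤ => φ (JordanVOA.wordV B hB r a b m) * ∏ i, z i ^ (-m i - 1))
          (∑ σ : derangements (Fin n),
            JordanVOA.gammaT B a b σ * JordanVOA.gammaZ z σ *
              r ^ (σ : Equiv.Perm (Fin n)).cycleFactorsFinset.card) := by
  obtain ⟨F, h1, h0, hF⟩ := JordanVOA.exists_vacuum_functional B hB hN r
  have hiff := JordanVOA.isVacuumFunctional_iff B hB r hN F h1 h0
  refine ⟨⟨_, (hiff _).2 rfl, fun φ hφ => (hiff φ).1 hφ⟩, fun φ hφ n a b z hz => ?_⟩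
  obtain rfl := (hiff φ).1 hφ
  -- The series over all pairs (m, k) converges; its partial sums over k are finite sums giving the
  -- matrix coefficients of the modes.
  have hs := (JordanVOA.hasSum_corrPoly B hB hz a b (r / 2)).prod_fiberwise
    (g := fun m => F (JordanVOA.modeWord B hB r a b m) * ∏ i, z i ^ (-m i - 1)) fun m => by
      have := (JordanVOA.hasSum_functional_modeWord B hB r F a b m).mul_right
        (∏ i, z i ^ (-m i - 1))
      simpa only [hF] using this
  convert! hs using 1
  refine Finset.sum_congr rfl fun σ _ => ?_
  -- Evaluation at r/2, the number of complex bosons, accounts for the factor 2^(-s) in Γ(σ,T).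
  rw [JordanVOA.gammaT_eq B hB a b σ σ.2, ← Finset.sum_mul, div_eq_mul_one_div r 2, mul_pow]
  ring
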